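/- **Theorem 11.2.** Let $\Omega\subseteq\mathbb R^3$ be open and $T>0$. Let $\varepsilon,\mu,\sigma:\Omega\to\mathbb R^{3\times3}$ be bounded measurable fields of symmetric matrices, with $\varepsilon,\mu$ uniformly positive definite and $\sigma$ positive semidefinite, and put $\Gamma=\mathrm{diag}(\varepsilon,\mu)$. For $a<b$ let $U_{[a,b]}=L^2([a,b]\times\Omega;\mathbb R^6)$, with elements $u=(u_E,u_H)$ and the energy inner product $$\langle u,v\rangle_U=\int_a^b\!\!\int_\Omega\big(\varepsilon u_E\cdot v_E+\mu u_H\cdot v_H\big)\,dx\,dt .$$ For $q=(q_E,q_H)\in U_{[a,b]}$ let $Fq=(E,H)\in U_{[a,b]}$ be the solution of Maxwell's equations $$\varepsilon\,\partial_tE-\operatorname{curl}H+\sigma E=q_E,\qquad \mu\,\partial_tH+\operatorname{curl}E=q_H\qquad\text{on } [a,b]\times\Omega,$$ with zero initial values at $t=a$ and zero boundary values on $\partial\Omega$. This is understood in the weak sense: for all $\eta,\zeta\in C_c^\infty((-\infty,b)\times\mathbb R^3;\mathbb R^3)$ (not required to vanish at $t=a$ or on $\partial\Omega$), $$\int_a^b\!\!\int_\Omega\big(-\varepsilon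 E\cdot\partial_t\eta-H\cdot\operatorname{curl}\eta+\sigma E\cdot\eta\big)=\int_a^b\!\!\int_\Omega q_E\cdot\eta,\qquad \int_a^b\!\!\int_\Omega\big(-\mu H\cdot\partial_t\zeta+E\cdot\operatorname{curl}\zeta\big)=\int_a^b\!\!\int_\Omega q_H\cdot\zeta .$$ The domain $D(F_{[a,b]})$ of $F$ over $[a,b]$ consists of the sources $q\in U_{[a,b]}$ for which such a solution exists (no energy reaches $\partial\Omega$ during $[a,b]$). The electromagnetic time-reversal operator is $$(\mathcal S_e q)(x,t)=\big(-q_E(x,2T-t),\;q_H(x,2T-t)\big),$$ which maps $U_{[0,T]}$ to $U_{[T,2T]}$ and $U_{[T,2T]}$ to $U_{[0,T]}$. Then: 1. Solutions are unique, so $F$ is well defined on its domain; if $\Omega=\mathbb R^3$, then $D(F_{[a,b]})=U_{[a,b]}$ for all $a<b$. 2. For every $v=(\phi,\psi)\in U_{[0,T]}$ with $\mathcal S_e\Gamma v\in D(F_{[T,2T]})$, we have $$\langle Fq,\,v\rangle_U=\langle q,\;\Gamma^{-1}\mathcal S_eF\mathcal S_e\Gamma v\rangle_U\qquad\text{for all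 } q\in D(F_{[0,T]}),$$ and, if $D(F_{[0,T]})$ is dense in $U_{[0,T]}$, then $\Gamma^{-1}\mathcal S_eF\mathcal S_e\Gamma v$ is the only element of $U_{[0,T]}$ with this property. 3. If $F$ is defined on all of $U$, over $[0,T]$ and over $[T,2T]$ (for instance if $\Omega=\mathbb R^3$), then $F$ over $[0,T]$ is a bounded linear operator on $U_{[0,T]}$, it has a unique adjoint $F^*$ with respect to $\langle\cdot,\cdot\rangle_U$, and $$\Gamma^{-1}\mathcal S_e F\mathcal S_e\Gamma\,v=F^*v\qquad\text{for all } v=(\phi,\psi)\in U_{[0,T]} .$$ -/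

import Mathlib

open MeasureTheory Set
open scoped ContDiff InnerProductSpace Matrix

noncomputable section

/-- Three-dimensional Euclidean space. -/
abbrev V3 : Type := EuclideanSpace ℝ (Fin 3)

/-- Values of electromagnetic fields: pairs `(E, H)` of vectors, with the Euclidean structure
of `ℝ⁶`.  The electric part is `.fst`, the magnetic part is `.snd`. -/
abbrev V6 : Type := WithLp 2 (V3 × V3)

/-- The product of a `3 × 3` matrix and a vector. -/
def matVec (A : Matrix (Fin 3) (Fin 3) ℝ) (v : V3) : V3 := WithLp.toLp 2 (A *ᵥ v.ofLp)

/-- A matrix field that is measurable, and bounded on `Ω`. -/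
def IsBddMeas (Ω : Set V3) (A : V3 → Matrix (Fin 3) (Fin 3) ℝ) : Prop :=
  (∀ i j, Measurable fun x => A x i j) ∧ ∃ C : ℝ, ∀ x ∈ Ω, ∀ i j, |A x i j| ≤ C

/-- A matrix field that is symmetric and uniformly positive definite on `Ω`. -/
def IsUnifPosDef (Ω : Set V3) (A : V3 → Matrix (Fin 3) (Fin 3) ℝ) : Prop :=
  (∀ x ∈ Ω, (A x).IsSymm) ∧
    ∃ c : ℝ, 0 < c ∧ ∀ x ∈ Ω, ∀ v : V3, c * ‖v‖ ^ 2 ≤ ⟪matVec (A x) v, v⟫_ℝ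

/-- An anisotropic conducting medium in `Ω`: permittivity `ε` and permeability `μ`, symmetric and
uniformly positive definite, and conductivity `σ`, symmetric and positive semidefinite.
All coefficients are bounded and measurable, and do not depend on time. -/
structure Medium (Ω : Set V3) where
  /-- permittivity -/
  ε : V3 → Matrix (Fin 3) (Fin 3) ℝ
  /-- permeability -/
  μ : V3 → Matrix (Fin 3) (Fin 3) ℝ
  /-- conductivity -/
  σ : V3 → Matrix (Fin 3) (Fin 3) ℝ
  ε_bdd : IsBddMeas Ω ε
  μ_bdd : IsBddMeas Ω μ
  σ_bdd : IsBddMeas Ω σ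
  ε_pos : IsUnifPosDef Ω ε
  μ_pos : IsUnifPosDef Ω μ
  σ_nonneg : ∀ x ∈ Ω, (σ x).PosSemidef

/-- Lebesgue measure on the space-time cylinder `[a, b] × Ω`. -/
def cylMeasure (Ω : Set V3) (a b : ℝ) : Measure (ℝ × V3) :=
  (volume : Measure (ℝ × V3)).restrict (Icc a b ×ˢ Ω)

/-- The space of sources and of fields over the time interval `[a, b]`: square-integrable
functions `(t, x) ↦ (E, H)` on `[a, b] × Ω`, up to almost everywhere equality. -/
abbrev FieldSpace (Ω : Set V3) (a b : ℝ) : Type := Lp V6 2 (cylMeasure Ω a b)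

/-! ### Multiplication by block diagonal matrix fields -/

/-- The function `diag(A, B) u`. -/
def blockFun (A B : V3 → Matrix (Fin 3) (Fin 3) ℝ) (u : ℝ × V3 → V6) : ℝ × V3 → V6 :=
  fun p => WithLp.toLp 2 (matVec (A p.2) (u p).fst, matVec (B p.2) (u p).snd)

theorem norm_matVec_le {A : Matrix (Fin 3) (Fin 3) ℝ} {C : ℝ} (h : ∀ i j, |A i j| ≤ C) (v : V3) :
    ‖matVec A v‖ ≤ 9 * C * ‖v‖ := by
  have hC : 0 ≤ C := (abs_nonneg _).trans (h 0 0)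
  have hv : ∀ j, |v j| ≤ ‖v‖ := fun j => by
    simpa using PiLp.norm_apply_le v j
  have hcomp : ∀ i, ‖(matVec A v) i‖ ≤ 3 * C * ‖v‖ := by
    intro i
    have h1 : (matVec A v) i = ∑ j, A i j * v j := rfl
    rw [h1, Real.norm_eq_abs]
    calc |∑ j, A i j * v j| ≤ ∑ j, |A i j * v j| := Finset.abs_sum_le_sum_abs _ _
      _ ≤ ∑ _j : Fin 3, C * ‖v‖ := by
          refine Finset.sum_le_sum fun j _ => ?_
          rw [abs_mul]
          exact mul_le_mul (h i j) (hv j) (abs_nonneg _) hC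
      _ = 3 * C * ‖v‖ := by simp; ring
  have hK : 0 ≤ 3 * C * ‖v‖ := by positivity
  rw [EuclideanSpace.norm_eq]
  refine Real.sqrt_le_iff.mpr ⟨by positivity, ?_⟩
  calc ∑ i, ‖(matVec A v) i‖ ^ 2 ≤ ∑ _i : Fin 3, (3 * C * ‖v‖) ^ 2 :=
        Finset.sum_le_sum fun i _ => pow_le_pow_left₀ (norm_nonneg _) (hcomp i) 2
    _ ≤ (9 * C * ‖v‖) ^ 2 := by
        simp only [Finset.sum_const, Finset.card_univ, Fintype.card_fin, nsmul_eq_mul]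
        push_cast
        nlinarith [sq_nonneg (C * ‖v‖)]

theorem aestronglyMeasurable_matVec {m : Measure (ℝ × V3)}
    {A : V3 → Matrix (Fin 3) (Fin 3) ℝ} (hA : ∀ i j, Measurable fun x => A x i j)
    {e : ℝ × V3 → V3} (he : AEStronglyMeasurable e m) :
    AEStronglyMeasurable (fun p => matVec (A p.2) (e p)) m := by
  have hcoord : ∀ j, AEMeasurable (fun p => e p j) m := fun j =>
    ((EuclideanSpace.proj (𝕜 := ℝ) j).continuous.comp_aestronglyMeasurable he).aemeasurable
  have h1 : AEMeasurable (fun p => (A p.2) *ᵥ (e p).ofLp) m := by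
    refine aemeasurable_pi_lambda _ fun i => ?_
    have : (fun p => ((A p.2) *ᵥ (e p).ofLp) i) = fun p => ∑ j, A p.2 i j * e p j := rfl
    rw [this]
    exact Finset.aemeasurable_fun_sum _ fun j _ =>
      (((hA i j).comp measurable_snd).aemeasurable).mul (hcoord j)
  exact (PiLp.continuous_toLp 2 _).comp_aestronglyMeasurable h1.aestronglyMeasurable

theorem memLp_blockFun {Ω : Set V3} (hΩ : MeasurableSet Ω) {a b : ℝ}
    {A B : V3 → Matrix (Fin 3) (Fin 3) ℝ} (hA : IsBddMeas Ω A) (hB : IsBddMeas Ω B)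
    (u : FieldSpace Ω a b) : MemLp (blockFun A B u) 2 (cylMeasure Ω a b) := by
  obtain ⟨hAm, C, hC⟩ := hA
  obtain ⟨hBm, D, hD⟩ := hB
  have hu : AEStronglyMeasurable (u : ℝ × V3 → V6) (cylMeasure Ω a b) := Lp.aestronglyMeasurable u
  have h1 : AEStronglyMeasurable (fun p => (u p).fst) (cylMeasure Ω a b) :=
    (WithLp.fstL 2 ℝ V3 V3).continuous.comp_aestronglyMeasurable hu
  have h2 : AEStronglyMeasurable (fun p => (u p).snd) (cylMeasure Ω a b) :=
    (WithLp.sndL 2 ℝ V3 V3).continuous.comp_aestronglyMeasurable hu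
  have hm : AEStronglyMeasurable (blockFun A B u) (cylMeasure Ω a b) :=
    (WithLp.prod_continuous_toLp 2 V3 V3).comp_aestronglyMeasurable
      ((aestronglyMeasurable_matVec hAm h1).prodMk (aestronglyMeasurable_matVec hBm h2))
  refine (Lp.memLp u).of_le_mul (c := 9 * (|C| + |D|)) hm ?_
  have hae : ∀ᵐ p ∂(cylMeasure Ω a b), p ∈ Icc a b ×ˢ Ω :=
    ae_restrict_mem (measurableSet_Icc.prod hΩ)
  filter_upwards [hae] with p hp
  have hK : 0 ≤ 9 * (|C| + |D|) := by positivity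
  have hE := norm_matVec_le (C := |C| + |D|)
    (fun i j => (hC p.2 hp.2 i j).trans ((le_abs_self C).trans (by simp))) (u p).fst
  have hH := norm_matVec_le (C := |C| + |D|)
    (fun i j => (hD p.2 hp.2 i j).trans ((le_abs_self D).trans (by simp))) (u p).snd
  rw [← abs_of_nonneg (norm_nonneg (blockFun A B u p)),
    ← abs_of_nonneg (mul_nonneg hK (norm_nonneg (u p)))]
  refine abs_le_abs_of_nonneg (norm_nonneg _) ?_
  refine le_of_sq_le_sq ?_ (mul_nonneg hK (norm_nonneg _))
  rw [mul_pow, WithLp.prod_norm_sq_eq_of_L2, WithLp.prod_norm_sq_eq_of_L2, mul_add, ← mul_pow,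
    ← mul_pow]
  exact add_le_add (pow_le_pow_left₀ (norm_nonneg _) hE 2) (pow_le_pow_left₀ (norm_nonneg _) hH 2)

/-- The operator of multiplication by `diag(A(x), B(x))`. -/
def blockMul {Ω : Set V3} (hΩ : IsOpen Ω) {A B : V3 → Matrix (Fin 3) (Fin 3) ℝ}
    (hA : IsBddMeas Ω A) (hB : IsBddMeas Ω B) {a b : ℝ} (u : FieldSpace Ω a b) :
    FieldSpace Ω a b :=
  (memLp_blockFun hΩ.measurableSet hA hB u).toLp (blockFun A B u)

/-- The pointwise inverse of a uniformly positive definite matrix field is bounded and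
measurable. -/
theorem IsBddMeas.inv {Ω : Set V3} {A : V3 → Matrix (Fin 3) (Fin 3) ℝ} (hA : IsBddMeas Ω A)
    (hpos : IsUnifPosDef Ω A) : IsBddMeas Ω fun x => (A x)⁻¹ := by
  obtain ⟨hm, -⟩ := hA
  obtain ⟨-, c, hc, hcoer⟩ := hpos
  refine ⟨fun i j => ?_, c⁻¹, fun x hx i j => ?_⟩
  · have hdet : Measurable fun x => (A x).det := by
      simp only [Matrix.det_fin_three]
      fun_prop
    have hadj : Measurable fun x => (A x).adjugate i j := by
      simp only [Matrix.adjugate_fin_three]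
      fin_cases i <;> fin_cases j <;> simp <;> fun_prop
    have : (fun x => (A x)⁻¹ i j) = fun x => ((A x).det)⁻¹ * (A x).adjugate i j := by
      funext x
      simp [Matrix.inv_def]
    rw [this]
    exact hdet.inv.mul hadj
  · have hdet : IsUnit (A x).det := by
      rw [isUnit_iff_ne_zero]
      intro h0
      obtain ⟨v, hv, hv0⟩ := Matrix.exists_mulVec_eq_zero_iff.mpr h0
      have h1 := hcoer x hx (WithLp.toLp 2 v)
      have h2 : matVec (A x) (WithLp.toLp 2 v) = 0 := by
        simp [matVec, hv0]
      rw [h2, inner_zero_left] at h1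
      have h3 : 0 < ‖(WithLp.toLp 2 v : V3)‖ := by
        rw [norm_pos_iff]
        simpa using hv
      nlinarith [mul_pos hc (pow_pos h3 2)]
    set w : V3 := matVec (A x)⁻¹ (EuclideanSpace.single j 1) with hw
    have hwi : w i = (A x)⁻¹ i j := by
      simp [hw, matVec]
    have hAw : matVec (A x) w = EuclideanSpace.single j 1 := by
      have h5 : (A x) *ᵥ ((A x)⁻¹ *ᵥ (EuclideanSpace.single j (1 : ℝ) : V3).ofLp)
          = (EuclideanSpace.single j (1 : ℝ) : V3).ofLp := by
        rw [Matrix.mulVec_mulVec, Matrix.mul_nonsing_inv _ hdet, Matrix.one_mulVec]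
      simp only [hw, matVec]
      rw [h5]
    have h1 := hcoer x hx w
    rw [hAw] at h1
    have h2 : ⟪(EuclideanSpace.single j 1 : V3), w⟫_ℝ ≤ ‖w‖ := by
      simpa using real_inner_le_norm (EuclideanSpace.single j 1 : V3) w
    have h3 : c * ‖w‖ ≤ 1 := by
      by_contra! hcon
      have hpos : 0 < ‖w‖ := by
        rcases (norm_nonneg w).eq_or_lt with h | h
        · rw [← h] at hcon; linarith
        · exact h
      nlinarith
    have h4 : |w i| ≤ ‖w‖ := by simpa using PiLp.norm_apply_le w i
    change |(A x)⁻¹ i j| ≤ c⁻¹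
    rw [← hwi]
    refine h4.trans ?_
    rw [inv_eq_one_div, le_div_iff₀ hc]
    linarith

namespace Medium

variable {Ω : Set V3}

/-- Multiplication by `Γ = diag(ε, μ)`. -/
def gamma (M : Medium Ω) (hΩ : IsOpen Ω) {a b : ℝ} : FieldSpace Ω a b → FieldSpace Ω a b :=
  blockMul hΩ M.ε_bdd M.μ_bdd

/-- Multiplication by `Γ⁻¹ = diag(ε⁻¹, μ⁻¹)`. -/
def gammaInv (M : Medium Ω) (hΩ : IsOpen Ω) {a b : ℝ} : FieldSpace Ω a b → FieldSpace Ω a b :=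
  blockMul hΩ (M.ε_bdd.inv M.ε_pos) (M.μ_bdd.inv M.μ_pos)

/-- The energy inner product
`⟨u, v⟩_U = ∫_[a,b] ∫_Ω (ε u_E · v_E + μ u_H · v_H) dx dt`. -/
def energyInner (M : Medium Ω) {a b : ℝ} (u v : FieldSpace Ω a b) : ℝ :=
  ∫ p, (⟪matVec (M.ε p.2) (u p).fst, (v p).fst⟫_ℝ +
    ⟪matVec (M.μ p.2) (u p).snd, (v p).snd⟫_ℝ) ∂(cylMeasure Ω a b)

end Medium

/-! ### Maxwell's equations -/

/-- The time derivative of a smooth vector field on space-time. -/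
def timeDeriv (η : ℝ × V3 → V3) (p : ℝ × V3) : V3 := fderiv ℝ η p (1, 0)

/-- `spaceDeriv η i j p` is `∂η_j/∂x_i` at `p`. -/
def spaceDeriv (η : ℝ × V3 → V3) (i j : Fin 3) (p : ℝ × V3) : ℝ :=
  (fderiv ℝ η p (0, EuclideanSpace.single i 1)) j

/-- The spatial curl of a smooth vector field on space-time. -/
def curl (η : ℝ × V3 → V3) (p : ℝ × V3) : V3 :=
  !₂[spaceDeriv η 1 2 p - spaceDeriv η 2 1 p,
    spaceDeriv η 2 0 p - spaceDeriv η 0 2 p,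
    spaceDeriv η 0 1 p - spaceDeriv η 1 0 p]

/-- Smooth compactly supported test fields on `ℝ × ℝ³` that vanish near and after the final
time `b`.  They need not vanish at the initial time or on the boundary of `Ω`. -/
def IsTestField (b : ℝ) (η : ℝ × V3 → V3) : Prop :=
  ContDiff ℝ ∞ η ∧ HasCompactSupport η ∧ ∀ p ∈ tsupport η, p.1 < b

/-- `u = (E, H)` is the (weak, square-integrable) solution, over the time interval `[a, b]`, of
Maxwell's equations
`ε ∂E/∂t - curl H + σ E = q_E`,  `μ ∂H/∂t + curl E = q_H`  in `Ω`,
with zero initial values `E(a) = H(a) = 0` and zero boundary values on `∂Ω`.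

Each equation is multiplied by a test field and integrated by parts.  As the test fields are
arbitrary at the initial time and on `∂Ω`, the absence of initial and boundary terms from Green's
formula expresses the zero initial and boundary conditions (on `∂Ω`, for the components of `E` and
`H` that enter Green's formula: no energy reaches the boundary). -/
def IsMaxwellSolution {Ω : Set V3} (M : Medium Ω) {a b : ℝ} (q u : FieldSpace Ω a b) : Prop :=
  (∀ η : ℝ × V3 → V3, IsTestField b η →
    ∫ p, (-⟪matVec (M.ε p.2) (u p).fst, timeDeriv η p⟫_ℝ - ⟪(u p).snd, curl η p⟫_ℝ
        + ⟪matVec (M.σ p.2) (u p).fst, η p⟫_ℝ) ∂(cylMeasure Ω a b)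
      = ∫ p, ⟪(q p).fst, η p⟫_ℝ ∂(cylMeasure Ω a b)) ∧
  (∀ ζ : ℝ × V3 → V3, IsTestField b ζ →
    ∫ p, (-⟪matVec (M.μ p.2) (u p).snd, timeDeriv ζ p⟫_ℝ
        + ⟪(u p).fst, curl ζ p⟫_ℝ) ∂(cylMeasure Ω a b)
      = ∫ p, ⟪(q p).snd, ζ p⟫_ℝ ∂(cylMeasure Ω a b))

/-- The domain of the source-to-field operator `F` over `[a, b]`: the sources `q` for which the
system with zero initial and boundary values has a solution, i.e. whose waves transport no energy
to `∂Ω` during `[a, b]`. -/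
def sourceDomain {Ω : Set V3} (M : Medium Ω) (a b : ℝ) : Set (FieldSpace Ω a b) :=
  {q | ∃ u, IsMaxwellSolution M q u}

open scoped Classical in
/-- The operator `F` over the time interval `[a, b]`, which maps a source to the field that it
generates (by convention `0` outside the domain). -/
def sourceToField {Ω : Set V3} (M : Medium Ω) {a b : ℝ} (q : FieldSpace Ω a b) :
    FieldSpace Ω a b :=
  if h : ∃ u, IsMaxwellSolution M q u then h.choose else 0

/-- `z` is a value at `v` of the adjoint of `F` (over `[a, b]`) for the energy inner product:
`⟨F q, v⟩_U = ⟨q, z⟩_U` for all `q` in the domain of `F`. -/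
def IsAdjointValue {Ω : Set V3} (M : Medium Ω) {a b : ℝ} (v z : FieldSpace Ω a b) : Prop :=
  ∀ q ∈ sourceDomain M a b, M.energyInner (sourceToField M q) v = M.energyInner q z

/-! ### The electromagnetic time-reversal operator -/

/-- The function `(t, x) ↦ (-q_E(2T - t, x), q_H(2T - t, x))`. -/
def reverseFun (T : ℝ) (q : ℝ × V3 → V6) : ℝ × V3 → V6 :=
  fun p => WithLp.toLp 2 (-(q (2 * T - p.1, p.2)).fst, (q (2 * T - p.1, p.2)).snd)

theorem measurePreserving_reverse {Ω : Set V3} (hΩ : MeasurableSet Ω) {T a b a' b' : ℝ}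
    (h : a + b' = 2 * T) (h' : b + a' = 2 * T) :
    MeasurePreserving (fun p : ℝ × V3 => (2 * T - p.1, p.2)) (cylMeasure Ω a' b')
      (cylMeasure Ω a b) := by
  have h1 : MeasurePreserving (fun p : ℝ × V3 => (2 * T - p.1, p.2)) volume volume :=
    (Measure.measurePreserving_sub_left (volume : Measure ℝ) (2 * T)).prod
      (MeasurePreserving.id (volume : Measure V3))
  have h2 : (fun p : ℝ × V3 => (2 * T - p.1, p.2)) ⁻¹' (Icc a b ×ˢ Ω) = Icc a' b' ×ˢ Ω := by
    ext ⟨t, x⟩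
    simp only [mem_preimage, mem_prod, mem_Icc]
    constructor
    · rintro ⟨⟨h3, h4⟩, h5⟩
      exact ⟨⟨by linarith, by linarith⟩, h5⟩
    · rintro ⟨⟨h3, h4⟩, h5⟩
      exact ⟨⟨by linarith, by linarith⟩, h5⟩
  have h3 := h1.restrict_preimage (measurableSet_Icc.prod hΩ : MeasurableSet (Icc a b ×ˢ Ω))
  rw [h2] at h3
  exact h3

theorem memLp_reverseFun {Ω : Set V3} (hΩ : MeasurableSet Ω) {T a b a' b' : ℝ}
    (h : a + b' = 2 * T) (h' : b + a' = 2 * T) (q : FieldSpace Ω a b) :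
    MemLp (reverseFun T q) 2 (cylMeasure Ω a' b') := by
  have h1 : MemLp (fun p : ℝ × V3 => q (2 * T - p.1, p.2)) 2 (cylMeasure Ω a' b') :=
    (Lp.memLp q).comp_measurePreserving (measurePreserving_reverse hΩ h h')
  have hcont : Continuous fun w : V6 => (WithLp.toLp 2 (-w.fst, w.snd) : V6) :=
    (WithLp.prod_continuous_toLp 2 V3 V3).comp
      (((WithLp.fstL 2 ℝ V3 V3).continuous.neg).prodMk (WithLp.sndL 2 ℝ V3 V3).continuous)
  refine h1.of_le (hcont.comp_aestronglyMeasurable h1.1) (Filter.Eventually.of_forall fun p => ?_)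
  refine le_of_sq_le_sq ?_ (norm_nonneg _)
  simp [reverseFun, WithLp.prod_norm_sq_eq_of_L2]

/-- Time reversal `t ↦ 2T - t` together with a change of sign of the electric component, from
fields over `[a, b]` to fields over the reflected interval `[a', b']`. -/
def timeReversal {Ω : Set V3} (hΩ : IsOpen Ω) (T : ℝ) {a b a' b' : ℝ} (h : a + b' = 2 * T)
    (h' : b + a' = 2 * T) (q : FieldSpace Ω a b) : FieldSpace Ω a' b' :=
  (memLp_reverseFun hΩ.measurableSet h h' q).toLp (reverseFun T q)

/-- The electromagnetic time-reversal operator `𝒮_e` on fields over `[0, T]`; its values are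
fields over `[T, 2T]`. -/
def emReversal {Ω : Set V3} (hΩ : IsOpen Ω) (T : ℝ) (q : FieldSpace Ω 0 T) :
    FieldSpace Ω T (2 * T) :=
  timeReversal hΩ T (by ring) (by ring) q

/-- The electromagnetic time-reversal operator `𝒮_e` on fields over `[T, 2T]`; its values are
fields over `[0, T]`. -/
def emReversalBack {Ω : Set V3} (hΩ : IsOpen Ω) (T : ℝ) (u : FieldSpace Ω T (2 * T)) :
    FieldSpace Ω 0 T :=
  timeReversal hΩ T (by ring) (by ring) u

/-- The composition `Γ⁻¹ 𝒮_e F 𝒮_e Γ`, with `F` taken over `[T, 2T]`: the time-reversal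
experiment. -/
def reversalExperiment {Ω : Set V3} (hΩ : IsOpen Ω) (M : Medium Ω) (T : ℝ)
    (v : FieldSpace Ω 0 T) : FieldSpace Ω 0 T :=
  M.gammaInv hΩ (emReversalBack hΩ T (sourceToField M (emReversal hΩ T (M.gamma hΩ v))))

end

noncomputable section

open Filter Topology
open scoped Convolution Pointwise

/-! Write `u = (E, H)`, `S u = (curl H, -curl E)`, and `σ u` for `diag(σ, 0) u`. Maxwell's equations
are the symmetric hyperbolic system `Γ ∂ₜu - S u + σ u = q`. Time reversal with the sign change of
`E` reverses the sign of `Γ ∂ₜ` and of `S` but not of `σ`. So, if `w` solves the system with source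
`p` over the reflected interval, then `𝒮_e w` solves the formal adjoint equation `S W - Γ ∂ₜW + σ W
= 𝒮_e p` with zero final values. Green's formula then gives `⟨q, 𝒮_e w⟩ = ⟨u, 𝒮_e p⟩` in plain `L²`
(`inner_timeReversal`). The choice `p = 𝒮_e Γ v` turns this into the adjoint identity.

The difficulty is Green's formula for two weak solutions that are merely in `L²`, with coefficients
that are merely measurable in `x` (`pairing`). Each solution is tested with a mollification of the
other, by a kernel `ρ` supported in negative times, respectively by its reflection. Everything is
expressed through correlations `z ↦ ∫ g(p) · h(p - z) dp`, which are continuous. The spatial terms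
cancel by the symmetry of `S`, and there remains `∫ ∂ₜρ A = ∫ ρ B`. Here `A` vanishes on the time
axis, because `Γ` is symmetric and independent of time, and `B 0 = 0` is Green's formula. As only
time derivatives are left, the identity restricts to that axis, and `B 0 = 0` follows by continuity.
The commutator of `Γ` with spatial mollification never has to be estimated. Spatial cutoffs remove
the compact supports.

Uniqueness is the same formula applied to `u` and `ψ(t) u` with a decreasing weight `ψ`
(`IsMaxwellSolution.zeroExt_eq_zero_of_lt`). Existence in the whole space follows by duality from
the a priori bound `‖w‖ ≤ C ‖S w - Γ ∂ₜw + σ w‖` for test fields `w` (`IsTest.norm_vec_le`), through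
Hahn–Banach and Riesz. If `F` is defined everywhere, it is bounded by the closed graph theorem, and
its energy adjoint is `Γ⁻¹ F† Γ`, with `F†` the `L²` adjoint. -/

instance : (volume : Measure (ℝ × V3)).IsAddHaarMeasure :=
  inferInstanceAs ((volume : Measure ℝ).prod (volume : Measure V3)).IsAddHaarMeasure

/-! ### Correlations of square-integrable fields -/

/-- The correlation `z ↦ ∫ g(p) · h(p - z) dp` of two fields on space-time. -/
def correlation (g h : ℝ × V3 → V6) (z : ℝ × V3) : ℝ := ∫ p, ⟪g p, h (p - z)⟫_ℝ

theorem measurePreserving_sub_const (z : ℝ × V3) :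
    MeasurePreserving (fun p : ℝ × V3 => p - z) volume volume :=
  measurePreserving_sub_right volume z

theorem MeasureTheory.MemLp.translate {h : ℝ × V3 → V6} (hh : MemLp h 2) (z : ℝ × V3) :
    MemLp (fun p => h (p - z)) 2 :=
  hh.comp_measurePreserving (measurePreserving_sub_const z)

theorem MeasureTheory.MemLp.integrable_inner_two {α : Type*} [MeasurableSpace α] {m : Measure α}
    {g h : α → V6} (hg : MemLp g 2 m) (hh : MemLp h 2 m) :
    Integrable (fun p => ⟪g p, h p⟫_ℝ) m := by
  refine (hg.norm.integrable_mul hh.norm).mono' (hg.1.inner hh.1) (Eventually.of_forall fun p => ?_)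
  exact norm_inner_le_norm _ _

/-- Translations act continuously on `L²`. Continuity is what later permits restriction to the null
set `x = 0` and evaluation at the origin. -/
theorem continuous_correlation {g h : ℝ × V3 → V6} (hg : MemLp g 2) (hh : MemLp h 2) :
    Continuous (correlation g h) := by
  -- Composition with measure-preserving maps is continuous into `L²` for the compact-open topology
  -- on these maps, hence the bundled translations.
  let τ : ℝ × V3 → C(ℝ × V3, ℝ × V3) := fun z => ⟨fun p => p - z, by fun_prop⟩
  have hτ : Continuous τ := by
    refine ContinuousMap.continuous_of_continuous_uncurry _ ?_
    change Continuous fun q : (ℝ × V3) × (ℝ × V3) => q.2 - q.1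
    fun_prop
  have hmp : ∀ z, MeasurePreserving (τ z) volume volume := measurePreserving_sub_const
  have key : Continuous fun z => Lp.compMeasurePreserving (τ z) (hmp z) (hh.toLp h) :=
    Continuous.compMeasurePreservingLp continuous_const hτ hmp (by norm_num)
  have hcont : Continuous fun z =>
      ⟪hg.toLp g, Lp.compMeasurePreserving (τ z) (hmp z) (hh.toLp h)⟫_ℝ :=
    continuous_const.inner key
  convert hcont using 2 with z
  rw [L2.inner_def]
  refine integral_congr_ae ?_
  filter_upwards [hg.coeFn_toLp, Lp.coeFn_compMeasurePreserving (hh.toLp h) (hmp z),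
    (hmp z).quasiMeasurePreserving.ae hh.coeFn_toLp] with p h1 h2 h3
  rw [h1, h2, Function.comp_apply, h3]
  rfl

/-- Substitute `p ↦ p - z`. In the pairing this trades the reflection of a kernel for an exchange of
the two fields. -/
theorem correlation_swap (g h : ℝ × V3 → V6) (z : ℝ × V3) :
    correlation g h (-z) = correlation h g z := by
  unfold correlation
  rw [← (measurePreserving_sub_const z).integral_comp
    (Homeomorph.subRight z).measurableEmbedding]
  refine integral_congr_ae (Eventually.of_forall fun p => ?_)
  simp only [sub_neg_eq_add, sub_add_cancel]
  exact real_inner_comm _ _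

/-- The inner product is at most `‖g p‖² + ‖h (p - z)‖²`, whose integral over `p` does not depend on
`z`; the compact support of `ψ` then takes care of `z`. -/
theorem integrable_prod_inner_convolution {ψ : ℝ × V3 → ℝ} (hψ : Continuous ψ)
    (hs : HasCompactSupport ψ) {g h : ℝ × V3 → V6} (hg : MemLp g 2) (hh : MemLp h 2) :
    Integrable (Function.uncurry fun p z => ψ z * ⟪g p, h (p - z)⟫_ℝ)
      ((volume : Measure (ℝ × V3)).prod (volume : Measure (ℝ × V3))) := by
  have hm : AEStronglyMeasurable (Function.uncurry fun p z => ψ z * ⟪g p, h (p - z)⟫_ℝ)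
      ((volume : Measure (ℝ × V3)).prod (volume : Measure (ℝ × V3))) := by
    have h1 := (hψ.aestronglyMeasurable (μ := volume)).convolution_integrand
      (ContinuousLinearMap.lsmul ℝ ℝ) hh.1
    have h2 := (hg.1.comp_fst (ν := (volume : Measure (ℝ × V3)))).inner (𝕜 := ℝ) h1
    refine h2.congr (Eventually.of_forall fun p => ?_)
    simp [Function.uncurry, inner_smul_right]
  rw [integrable_prod_iff' hm]
  refine ⟨Eventually.of_forall fun z =>
    ((hg.integrable_inner_two (hh.translate z)).const_mul (ψ z)), ?_⟩
  have hC : Integrable (fun z => ‖ψ z‖ * ((∫ p, ‖g p‖ ^ 2) + ∫ p, ‖h p‖ ^ 2)) :=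
    (hψ.integrable_of_hasCompactSupport hs).norm.mul_const _
  refine hC.mono' hm.norm.prod_swap.integral_prod_right' (Eventually.of_forall fun z => ?_)
  have hg2 : Integrable fun p => ‖g p‖ ^ 2 := hg.integrable_norm_pow (by norm_num)
  have hh2 : Integrable fun p => ‖h (p - z)‖ ^ 2 :=
    (hh.translate z).integrable_norm_pow (by norm_num)
  have e : ∫ p, ‖h p‖ ^ 2 = ∫ p, ‖h (p - z)‖ ^ 2 :=
    ((measurePreserving_sub_const z).integral_comp
      (Homeomorph.subRight z).measurableEmbedding (fun p => ‖h p‖ ^ 2)).symm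
  rw [Real.norm_of_nonneg (integral_nonneg fun _ => norm_nonneg _), e, ← integral_add hg2 hh2,
    ← integral_const_mul]
  refine integral_mono_of_nonneg (Eventually.of_forall fun _ => norm_nonneg _)
    ((hg2.add hh2).const_mul _) (Eventually.of_forall fun p => ?_)
  simp only [Function.uncurry, norm_mul]
  refine mul_le_mul_of_nonneg_left ?_ (norm_nonneg _)
  refine (norm_inner_le_norm _ _).trans ?_
  nlinarith [sq_nonneg (‖g p‖ - ‖h (p - z)‖), sq_nonneg ‖g p‖, sq_nonneg ‖h (p - z)‖]

theorem inner_convolution {ψ : ℝ × V3 → ℝ} (hψ : Continuous ψ)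
    (hs : HasCompactSupport ψ) {g h : ℝ × V3 → V6} (hh : MemLp h 2) (p : ℝ × V3) :
    ⟪g p, (ψ ⋆[ContinuousLinearMap.lsmul ℝ ℝ, volume] h) p⟫_ℝ
      = ∫ z, ψ z * ⟪g p, h (p - z)⟫_ℝ := by
  have hi := hs.convolutionExists_left (ContinuousLinearMap.lsmul ℝ ℝ) hψ
    (hh.locallyIntegrable (by norm_num)) p
  rw [convolution_def, ← integral_inner hi]
  simp [inner_smul_right]

theorem integrable_inner_convolution {ψ : ℝ × V3 → ℝ} (hψ : Continuous ψ)
    (hs : HasCompactSupport ψ) {g h : ℝ × V3 → V6} (hg : MemLp g 2) (hh : MemLp h 2) :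
    Integrable fun p => ⟪g p, (ψ ⋆[ContinuousLinearMap.lsmul ℝ ℝ, volume] h) p⟫_ℝ := by
  refine (integrable_prod_inner_convolution hψ hs hg hh).integral_prod_left.congr
    (Eventually.of_forall fun p => ?_)
  exact (inner_convolution hψ hs hh p).symm

/-- Fubini. Testing `g` with a mollification of `h` involves the two fields only through their
correlation. -/
theorem integral_inner_convolution {ψ : ℝ × V3 → ℝ} (hψ : Continuous ψ)
    (hs : HasCompactSupport ψ) {g h : ℝ × V3 → V6} (hg : MemLp g 2) (hh : MemLp h 2) :
    ∫ p, ⟪g p, (ψ ⋆[ContinuousLinearMap.lsmul ℝ ℝ, volume] h) p⟫_ℝ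
      = ∫ z, ψ z * correlation g h z := by
  simp_rw [inner_convolution hψ hs hh]
  rw [integral_integral_swap (integrable_prod_inner_convolution hψ hs hg hh)]
  simp_rw [integral_const_mul]
  rfl

theorem fderiv_convolution_apply {F : Type*} [NormedAddCommGroup F] [NormedSpace ℝ F]
    {ρ : ℝ × V3 → ℝ} (hρ : ContDiff ℝ ∞ ρ) (hs : HasCompactSupport ρ)
    {h : ℝ × V3 → F} (hl : LocallyIntegrable h) (p v : ℝ × V3) :
    fderiv ℝ (ρ ⋆[ContinuousLinearMap.lsmul ℝ ℝ, volume] h) p v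
      = ((fun z => fderiv ℝ ρ z v) ⋆[ContinuousLinearMap.lsmul ℝ ℝ, volume] h) p := by
  have h1 : ContDiff ℝ 1 ρ := hρ.of_le (by simp)
  have hd := hs.hasFDerivAt_convolution_left (ContinuousLinearMap.lsmul ℝ ℝ) h1 hl p
  have hi := (hs.fderiv ℝ).convolutionExists_left
    ((ContinuousLinearMap.lsmul ℝ ℝ : ℝ →L[ℝ] F →L[ℝ] F).precompL (ℝ × V3))
    (h1.continuous_fderiv one_ne_zero) hl p
  rw [hd.fderiv, convolution_def, ContinuousLinearMap.integral_apply hi]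
  rfl

theorem clm_convolution {ψ : ℝ × V3 → ℝ} (hψ : Continuous ψ) (hs : HasCompactSupport ψ)
    {h : ℝ × V3 → V6} (hh : MemLp h 2) (A : V6 →L[ℝ] V6) (p : ℝ × V3) :
    A ((ψ ⋆[ContinuousLinearMap.lsmul ℝ ℝ, volume] h) p)
      = (ψ ⋆[ContinuousLinearMap.lsmul ℝ ℝ, volume] (fun z => A (h z))) p := by
  have hi := hs.convolutionExists_left (ContinuousLinearMap.lsmul ℝ ℝ) hψ
    (hh.locallyIntegrable (by norm_num)) p
  rw [convolution_def, convolution_def, ← A.integral_comp_comm hi]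
  simp

/-! ### First-order systems in weak form -/

/-- The cross product with the `i`-th basis vector. -/
def axisCross (i : Fin 3) : V3 →L[ℝ] V3 :=
  LinearMap.toContinuousLinearMap
    ((WithLp.linearEquiv 2 ℝ (Fin 3 → ℝ)).symm.toLinearMap ∘ₗ crossProduct (Pi.single i 1) ∘ₗ
      (WithLp.linearEquiv 2 ℝ (Fin 3 → ℝ)).toLinearMap)

theorem axisCross_apply (i : Fin 3) (v : V3) :
    axisCross i v = WithLp.toLp 2 (crossProduct (Pi.single i 1) v.ofLp) := rfl

theorem inner_axisCross (i : Fin 3) (v w : V3) : ⟪axisCross i v, w⟫_ℝ = -⟪v, axisCross i w⟫_ℝ := by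
  simp only [axisCross_apply, PiLp.inner_apply, Fin.sum_univ_three, crossProduct]
  fin_cases i <;> simp

/-- The matrix of the coefficient of `∂/∂xᵢ` in `(E, H) ↦ (curl H, -curl E)`, that is
`(e, h) ↦ (eᵢ × h, -eᵢ × e)`. -/
def symbol (i : Fin 3) : V6 →L[ℝ] V6 :=
  (WithLp.prodContinuousLinearEquiv 2 ℝ V3 V3).symm.toContinuousLinearMap ∘L
    ((axisCross i ∘L WithLp.sndL 2 ℝ V3 V3).prod (-(axisCross i ∘L WithLp.fstL 2 ℝ V3 V3)))

theorem symbol_apply (i : Fin 3) (v : V6) :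
    symbol i v = WithLp.toLp 2 (axisCross i v.snd, -axisCross i v.fst) := rfl

/-- The cross product with a fixed vector is skew, and the opposite signs of the two curls make the
block matrix symmetric. This removes the spatial terms both from Green's formula and from the energy
estimate. -/
theorem inner_symbol (i : Fin 3) (v w : V6) : ⟪symbol i v, w⟫_ℝ = ⟪v, symbol i w⟫_ℝ := by
  change ⟪axisCross i v.snd, w.fst⟫_ℝ + ⟪-axisCross i v.fst, w.snd⟫_ℝ
    = ⟪v.fst, axisCross i w.snd⟫_ℝ + ⟪v.snd, -axisCross i w.fst⟫_ℝ
  rw [inner_neg_left, inner_neg_right, inner_axisCross, inner_axisCross]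
  ring

/-- The time derivative of a field. -/
def tDeriv (w : ℝ × V3 → V6) (p : ℝ × V3) : V6 := fderiv ℝ w p (1, 0)

/-- The operator `(E, H) ↦ (curl H, -curl E)`. -/
def spaceOp (w : ℝ × V3 → V6) (p : ℝ × V3) : V6 :=
  ∑ i, symbol i (fderiv ℝ w p (0, EuclideanSpace.single i 1))

/-- Smooth compactly supported fields, whose support lies over the times in `I`. -/
structure IsTest (I : Set ℝ) (w : ℝ × V3 → V6) : Prop where
  contDiff : ContDiff ℝ ∞ w
  hasCompactSupport : HasCompactSupport w
  mem : ∀ p ∈ tsupport w, p.1 ∈ I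

/-- The weak form of `∂g/∂t - (curl u_H, -curl u_E) = r` over the times in `I`. -/
def WeakSystem (I : Set ℝ) (g u r : ℝ × V3 → V6) : Prop :=
  ∀ w, IsTest I w → ∫ p, (⟪u p, spaceOp w p⟫_ℝ - ⟪g p, tDeriv w p⟫_ℝ) = ∫ p, ⟪r p, w p⟫_ℝ

section tests

variable {I : Set ℝ} {w : ℝ × V3 → V6}

theorem IsTest.continuous_fderiv_apply (hw : IsTest I w) (v : ℝ × V3) :
    Continuous fun p => fderiv ℝ w p v :=
  (hw.contDiff.continuous_fderiv (by simp)).clm_apply continuous_const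

theorem IsTest.hasCompactSupport_fderiv_apply (hw : IsTest I w) (v : ℝ × V3) :
    HasCompactSupport fun p => fderiv ℝ w p v :=
  hw.hasCompactSupport.fderiv_apply ℝ v

theorem IsTest.continuous_tDeriv (hw : IsTest I w) : Continuous (tDeriv w) :=
  hw.continuous_fderiv_apply _

theorem IsTest.hasCompactSupport_tDeriv (hw : IsTest I w) : HasCompactSupport (tDeriv w) :=
  hw.hasCompactSupport_fderiv_apply _

theorem IsTest.continuous_spaceOp (hw : IsTest I w) : Continuous (spaceOp w) :=
  continuous_finsetSum _ fun i _ => (symbol i).continuous.comp (hw.continuous_fderiv_apply _)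

theorem IsTest.hasCompactSupport_spaceOp (hw : IsTest I w) : HasCompactSupport (spaceOp w) := by
  refine (hw.hasCompactSupport.fderiv ℝ).mono fun p hp => ?_
  contrapose! hp
  simp only [Function.mem_support, not_not] at hp ⊢
  simp [spaceOp, hp]

theorem memLp_of_hasCompactSupport {f : ℝ × V3 → V6} (hf : Continuous f)
    (hs : HasCompactSupport f) : MemLp f 2 :=
  hf.memLp_of_hasCompactSupport hs

theorem IsTest.memLp (hw : IsTest I w) : MemLp w 2 :=
  memLp_of_hasCompactSupport hw.contDiff.continuous hw.hasCompactSupport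

theorem IsTest.memLp_tDeriv (hw : IsTest I w) : MemLp (tDeriv w) 2 :=
  memLp_of_hasCompactSupport hw.continuous_tDeriv hw.hasCompactSupport_tDeriv

theorem IsTest.memLp_spaceOp (hw : IsTest I w) : MemLp (spaceOp w) 2 :=
  memLp_of_hasCompactSupport hw.continuous_spaceOp hw.hasCompactSupport_spaceOp

end tests

/-- The commutator of the spatial operator with multiplication by `χ`. -/
def gradSymbol (χ : ℝ × V3 → ℝ) (p : ℝ × V3) (v : V6) : V6 :=
  ∑ i, fderiv ℝ χ p (0, EuclideanSpace.single i 1) • symbol i v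

theorem inner_gradSymbol (χ : ℝ × V3 → ℝ) (p : ℝ × V3) (v w : V6) :
    ⟪gradSymbol χ p v, w⟫_ℝ = ⟪v, gradSymbol χ p w⟫_ℝ := by
  simp only [gradSymbol, sum_inner, inner_sum, inner_smul_left, inner_smul_right, inner_symbol]
  simp

section smul

variable {χ : ℝ × V3 → ℝ} {w : ℝ × V3 → V6}

theorem contDiff_smul_field {F : Type*} [NormedAddCommGroup F] [NormedSpace ℝ F]
    {w : ℝ × V3 → F} (hχ : ContDiff ℝ ∞ χ) (hw : ContDiff ℝ ∞ w) :
    ContDiff ℝ ∞ (fun p => χ p • w p) := hχ.smul hw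

theorem hasCompactSupport_smul_field {F : Type*} [NormedAddCommGroup F] [NormedSpace ℝ F]
    {w : ℝ × V3 → F} (hw : HasCompactSupport w) : HasCompactSupport (fun p => χ p • w p) :=
  hw.smul_left

theorem tsupport_smul_field_subset {F : Type*} [NormedAddCommGroup F] [NormedSpace ℝ F]
    {w : ℝ × V3 → F} : tsupport (fun p => χ p • w p) ⊆ tsupport χ ∩ tsupport w :=
  subset_inter (tsupport_smul_subset_left χ w) (tsupport_smul_subset_right χ w)

theorem fderiv_smul_apply' (hχ : ContDiff ℝ ∞ χ) (hw : ContDiff ℝ ∞ w) (p v : ℝ × V3) :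
    fderiv ℝ (fun p => χ p • w p) p v = χ p • fderiv ℝ w p v + fderiv ℝ χ p v • w p := by
  have h := fderiv_fun_smul (hχ.differentiable (by simp) p) (hw.differentiable (by simp) p)
  rw [h]
  simp

theorem tDeriv_smul (hχ : ContDiff ℝ ∞ χ) (hw : ContDiff ℝ ∞ w) (p : ℝ × V3) :
    tDeriv (fun p => χ p • w p) p = χ p • tDeriv w p + fderiv ℝ χ p (1, 0) • w p :=
  fderiv_smul_apply' hχ hw p _

theorem spaceOp_smul (hχ : ContDiff ℝ ∞ χ) (hw : ContDiff ℝ ∞ w) (p : ℝ × V3) :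
    spaceOp (fun p => χ p • w p) p = χ p • spaceOp w p + gradSymbol χ p (w p) := by
  simp only [spaceOp, gradSymbol, fderiv_smul_apply' hχ hw, map_add, map_smul,
    Finset.sum_add_distrib, Finset.smul_sum]

theorem IsTest.smul {I J : Set ℝ} (hχ : ContDiff ℝ ∞ χ) (hw : IsTest J w)
    (hIJ : ∀ p ∈ tsupport χ, p.1 ∈ J → p.1 ∈ I) : IsTest I (fun p => χ p • w p) :=
  ⟨contDiff_smul_field hχ hw.contDiff, hasCompactSupport_smul_field hw.hasCompactSupport,
    fun p hp => hIJ p (tsupport_smul_field_subset hp).1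
      (hw.mem p (tsupport_smul_field_subset hp).2)⟩

end smul

/-- A solution multiplied by a smooth scalar function solves a system with a modified source. -/
theorem WeakSystem.smul {I J : Set ℝ} {g u r : ℝ × V3 → V6} (H : WeakSystem I g u r)
    (hg : MemLp g 2) (hu : MemLp u 2) (hr : MemLp r 2) {χ : ℝ × V3 → ℝ} (hχ : ContDiff ℝ ∞ χ)
    (hIJ : ∀ p ∈ tsupport χ, p.1 ∈ J → p.1 ∈ I) :
    WeakSystem J (fun p => χ p • g p) (fun p => χ p • u p)
      (fun p => χ p • r p + fderiv ℝ χ p (1, 0) • g p - gradSymbol χ p (u p)) := by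
  intro w hw
  have hW := hw.smul hχ hIJ
  have h := H _ hW
  -- As the difference of `spaceOp (χ w)` and `χ spaceOp w`, both continuous with compact support,
  -- this is in `L²` without any bound on `χ`.
  have hB1 : MemLp (fun p => gradSymbol χ p (w p)) 2 := by
    refine (hW.memLp_spaceOp.sub (memLp_of_hasCompactSupport
      (hχ.continuous.smul hw.continuous_spaceOp) hw.hasCompactSupport_spaceOp.smul_left)).ae_eq
      (Eventually.of_forall fun p => ?_)
    simp [spaceOp_smul hχ hw.contDiff]
  have hB2 : MemLp (fun p => fderiv ℝ χ p (1, 0) • w p) 2 := by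
    refine (hW.memLp_tDeriv.sub (memLp_of_hasCompactSupport
      (hχ.continuous.smul hw.continuous_tDeriv) hw.hasCompactSupport_tDeriv.smul_left)).ae_eq
      (Eventually.of_forall fun p => ?_)
    simp [tDeriv_smul hχ hw.contDiff]
  have iB := (hu.integrable_inner_two hB1).sub (hg.integrable_inner_two hB2)
  have iA := (hu.integrable_inner_two hW.memLp_spaceOp).sub
    (hg.integrable_inner_two hW.memLp_tDeriv)
  have iR := hr.integrable_inner_two hW.memLp
  have e1 := integral_sub iA iB
  have e2 := integral_sub iR iB
  simp only [Pi.sub_apply] at e1 e2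
  rw [h, ← e2] at e1
  convert e1 using 1
  · refine integral_congr_ae (Eventually.of_forall fun p => ?_)
    simp only [spaceOp_smul hχ hw.contDiff, tDeriv_smul hχ hw.contDiff, inner_add_right,
      inner_smul_left, inner_smul_right]
    simp only [conj_trivial]
    ring
  · refine integral_congr_ae (Eventually.of_forall fun p => ?_)
    simp only [inner_sub_left, inner_add_left, inner_gradSymbol, inner_smul_left,
      inner_smul_right]
    simp only [conj_trivial]
    ring

/-! ### Testing with convolutions -/

/-- Supports add under convolution. A kernel at negative times moves a field that lives up to time
`b` strictly before `b`, and so makes an admissible test field of it. -/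
theorem isTest_convolution {I : Set ℝ} {ρ : ℝ × V3 → ℝ} (hρ : ContDiff ℝ ∞ ρ)
    (hs : HasCompactSupport ρ) {h : ℝ × V3 → V6} (hh : MemLp h 2) (hc : HasCompactSupport h)
    (hI : ∀ z ∈ tsupport ρ, ∀ y ∈ tsupport h, z.1 + y.1 ∈ I) :
    IsTest I (ρ ⋆[ContinuousLinearMap.lsmul ℝ ℝ, volume] h) := by
  refine ⟨hs.contDiff_convolution_left (n := ⊤) _ hρ (hh.locallyIntegrable (by norm_num)),
    hs.convolution _ hc, fun p hp => ?_⟩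
  have hcl : IsClosed (tsupport ρ + tsupport h) := (hs.isCompact.add hc.isCompact).isClosed
  have hsub : tsupport (ρ ⋆[ContinuousLinearMap.lsmul ℝ ℝ, volume] h)
      ⊆ tsupport ρ + tsupport h :=
    closure_minimal ((support_convolution_subset _).trans
      (add_subset_add subset_closure subset_closure)) hcl
  obtain ⟨z, hz, y, hy, rfl⟩ := hsub hp
  exact hI z hz y hy

/-- This is the weak equation tested with `ρ ⋆ h`. All derivatives fall on `ρ`, so `h` need only be
square-integrable, and in particular may be another weak solution. -/
theorem WeakSystem.correlation {I : Set ℝ} {g u r : ℝ × V3 → V6} (H : WeakSystem I g u r)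
    (hg : MemLp g 2) (hu : MemLp u 2) (hr : MemLp r 2) {ρ : ℝ × V3 → ℝ} (hρ : ContDiff ℝ ∞ ρ)
    (hs : HasCompactSupport ρ) {h : ℝ × V3 → V6} (hh : MemLp h 2) (hc : HasCompactSupport h)
    (hI : ∀ z ∈ tsupport ρ, ∀ y ∈ tsupport h, z.1 + y.1 ∈ I) :
    ∑ i, (∫ z, fderiv ℝ ρ z (0, EuclideanSpace.single i 1)
        * _root_.correlation u (fun p => symbol i (h p)) z)
      - ∫ z, fderiv ℝ ρ z (1, 0) * _root_.correlation g h z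
      = ∫ z, ρ z * _root_.correlation r h z := by
  have hl : LocallyIntegrable h := hh.locallyIntegrable (by norm_num)
  have hd : ∀ v, Continuous fun z => fderiv ℝ ρ z v := fun v =>
    (hρ.continuous_fderiv (by simp)).clm_apply continuous_const
  have hds : ∀ v, HasCompactSupport fun z => fderiv ℝ ρ z v := fun v => hs.fderiv_apply ℝ v
  have hM : ∀ i, MemLp (fun p => symbol i (h p)) 2 := fun i =>
    (symbol i).comp_memLp' hh
  have key := H _ (isTest_convolution hρ hs hh hc hI)
  rw [integral_inner_convolution hρ.continuous hs hr hh] at key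
  rw [← key, ← integral_inner_convolution (hd _) (hds _) hg hh]
  simp_rw [← integral_inner_convolution (hd _) (hds _) hu (hM _)]
  rw [← integral_finsetSum _ fun i _ => integrable_inner_convolution (hd _) (hds _) hu (hM i),
    ← integral_sub (integrable_finsetSum _ fun i _ =>
      integrable_inner_convolution (hd _) (hds _) hu (hM i))
      (integrable_inner_convolution (hd _) (hds _) hg hh)]
  refine integral_congr_ae (Eventually.of_forall fun p => ?_)
  simp only [spaceOp, tDeriv, fderiv_convolution_apply hρ hs hl, inner_sum,
    clm_convolution (hd _) (hds _) hh]

/-! ### The pairing of a forward and a backward solution -/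

/-- No spatial derivative occurs in the hypothesis. For fixed `α` it says that the continuous
function `ξ ↦ ∫ (α' A - α B)(s, ξ) ds` is orthogonal to every `β`; so it vanishes identically, in
particular at `ξ = 0`. -/
theorem integral_deriv_mul_sub_eq_zero {A B : ℝ × V3 → ℝ} (hA : Continuous A) (hB : Continuous B)
    (h : ∀ (α : ℝ → ℝ) (β : V3 → ℝ), ContDiff ℝ ∞ α → HasCompactSupport α → tsupport α ⊆ Iio 0 →
      ContDiff ℝ ∞ β → HasCompactSupport β →
      ∫ z : ℝ × V3, deriv α z.1 * β z.2 * A z = ∫ z : ℝ × V3, α z.1 * β z.2 * B z)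
    {α : ℝ → ℝ} (hα : ContDiff ℝ ∞ α) (hαs : HasCompactSupport α) (hα0 : tsupport α ⊆ Iio 0) :
    ∫ s, (deriv α s * A (s, 0) - α s * B (s, 0)) = 0 := by
  have hα' : Continuous (deriv α) := hα.continuous_deriv (by simp)
  let k : V3 → ℝ → ℝ := fun ξ s => deriv α s * A (s, ξ) - α s * B (s, ξ)
  have hk : Continuous k.uncurry := by
    have hs : Continuous fun q : V3 × ℝ => (q.2, q.1) := continuous_swap
    exact ((hα'.comp continuous_snd).mul (hA.comp hs)).sub
      ((hα.continuous.comp continuous_snd).mul (hB.comp hs))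
  have hsupp : ∀ ξ, Function.support (k ξ) ⊆ tsupport α := by
    intro ξ s hs
    by_contra hn
    have h1 : α s = 0 := image_eq_zero_of_notMem_tsupport hn
    have h2 : deriv α s = 0 := by
      by_contra h3
      exact hn (support_deriv_subset h3)
    exact hs (by simp [k, h1, h2])
  have hj : Continuous fun ξ => ∫ s, k ξ s := by
    have := continuous_parametric_integral_of_continuous (μ := (volume : Measure ℝ)) hk
      hαs.isCompact
    refine this.congr fun ξ => ?_
    exact setIntegral_eq_integral_of_forall_compl_eq_zero fun s hs => by
      by_contra h3
      exact hs (hsupp ξ h3)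
  have hzero : ∀ᵐ ξ : V3, ∫ s, k ξ s = 0 := by
    refine ae_eq_zero_of_integral_contDiff_smul_eq_zero hj.locallyIntegrable fun β hβ hβs => ?_
    have hcs : ∀ f : ℝ × V3 → ℝ, Continuous f → (∀ z, z.1 ∉ tsupport α → f z = 0) →
        Integrable fun z => f z * β z.2 := by
      intro f hf hf0
      refine (hf.mul (hβ.continuous.comp continuous_snd)).integrable_of_hasCompactSupport ?_
      refine HasCompactSupport.intro (hαs.isCompact.prod hβs.isCompact) fun z hz => ?_
      rw [mem_prod, not_and_or] at hz
      rcases hz with hz | hz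
      · simp [hf0 z hz]
      · simp [image_eq_zero_of_notMem_tsupport hz]
    have i1 : Integrable fun z : ℝ × V3 => deriv α z.1 * A z * β z.2 :=
      hcs (fun z => deriv α z.1 * A z) ((hα'.comp continuous_fst).mul hA) fun z hz => by
        have h2 : deriv α z.1 = 0 := by
          by_contra h3
          exact hz (support_deriv_subset h3)
        simp [h2]
    have i2 : Integrable fun z : ℝ × V3 => α z.1 * B z * β z.2 :=
      hcs (fun z => α z.1 * B z) ((hα.continuous.comp continuous_fst).mul hB) fun z hz => by
        simp [image_eq_zero_of_notMem_tsupport hz]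
    have e := h α β hα hαs hα0 hβ hβs
    have e' : ∫ z : ℝ × V3, (deriv α z.1 * A z * β z.2 - α z.1 * B z * β z.2) = 0 := by
      rw [integral_sub i1 i2, sub_eq_zero]
      simpa only [mul_right_comm] using e
    rw [Measure.volume_eq_prod, integral_prod_symm _ (by exact i1.sub i2)] at e'
    rw [← e']
    refine integral_congr_ae (Eventually.of_forall fun ξ => ?_)
    simp only [smul_eq_mul]
    rw [← integral_const_mul]
    refine integral_congr_ae (Eventually.of_forall fun s => ?_)
    simp only [k]
    ring
  -- Continuity upgrades almost every `ξ` to every `ξ`, which is needed to reach the single point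
  -- `0`.
  have := (hj.ae_eq_iff_eq volume continuous_const).mp hzero
  exact congr_fun this 0

/-- On the time axis only `∫ α(s) B(s, 0) ds = 0` is left. This gives `B(s, 0) = 0` for `s < 0`, and
the endpoint `s = 0` follows by continuity. -/
theorem eq_zero_of_tensor_test {A B : ℝ × V3 → ℝ} (hA : Continuous A) (hB : Continuous B)
    (hA0 : ∀ s, A (s, 0) = 0)
    (h : ∀ (α : ℝ → ℝ) (β : V3 → ℝ), ContDiff ℝ ∞ α → HasCompactSupport α → tsupport α ⊆ Iio 0 →
      ContDiff ℝ ∞ β → HasCompactSupport β →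
      ∫ z : ℝ × V3, deriv α z.1 * β z.2 * A z = ∫ z : ℝ × V3, α z.1 * β z.2 * B z) :
    B 0 = 0 := by
  have hB' : Continuous fun s : ℝ => B (s, 0) := hB.comp (by fun_prop)
  have h1 : ∀ᵐ s : ℝ, s ∈ Iio (0 : ℝ) → B (s, 0) = 0 := by
    refine isOpen_Iio.ae_eq_zero_of_integral_contDiff_smul_eq_zero
      (hB'.locallyIntegrable.locallyIntegrableOn _) fun α hα hαs hα0 => ?_
    have h2 := integral_deriv_mul_sub_eq_zero hA hB h hα hαs hα0
    simp only [hA0, mul_zero, zero_sub, integral_neg, neg_eq_zero] at h2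
    exact h2
  have h2 : EqOn (fun s : ℝ => B (s, 0)) (fun _ => 0) (Iio 0) :=
    Measure.eqOn_open_of_ae_eq ((ae_restrict_iff' measurableSet_Iio).mpr h1) isOpen_Iio
      hB'.continuousOn continuousOn_const
  have h3 := h2.closure hB' continuous_const
  rw [closure_Iio] at h3
  exact h3 (mem_Iic.mpr le_rfl)

theorem fderiv_tensor {α : ℝ → ℝ} {β : V3 → ℝ} (hα : ContDiff ℝ ∞ α) (hβ : ContDiff ℝ ∞ β)
    (z : ℝ × V3) : fderiv ℝ (fun z : ℝ × V3 => α z.1 * β z.2) z (1, 0) = deriv α z.1 * β z.2 := by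
  have h1 : HasFDerivAt (fun z : ℝ × V3 => α z.1)
      ((fderiv ℝ α z.1).comp (ContinuousLinearMap.fst ℝ ℝ V3)) z :=
    (hα.differentiable (by simp) z.1).hasFDerivAt.comp z hasFDerivAt_fst
  have h2 : HasFDerivAt (fun z : ℝ × V3 => β z.2)
      ((fderiv ℝ β z.2).comp (ContinuousLinearMap.snd ℝ ℝ V3)) z :=
    (hβ.differentiable (by simp) z.2).hasFDerivAt.comp z hasFDerivAt_snd
  rw [(h1.fun_mul h2).fderiv]
  simp [mul_comm]

/-- Test the equation of `u` with `ρ ⋆ w` and that of `w` with `ρ(-·) ⋆ u`. In the sum the spatial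
terms cancel, and `eq_zero_of_tensor_test` applies: `hcomp` asks for compatibility of `g` and `k`
under purely temporal shifts only. -/
theorem pairing_of_hasCompactSupport {a b : ℝ} {g u r k w l : ℝ × V3 → V6}
    (Hu : WeakSystem (Iio b) g u r) (Hw : WeakSystem (Ioi a) k w l)
    (hg : MemLp g 2) (hu : MemLp u 2) (hr : MemLp r 2)
    (hk : MemLp k 2) (hw : MemLp w 2) (hl : MemLp l 2)
    (cu : HasCompactSupport u) (cw : HasCompactSupport w)
    (su : ∀ p ∈ tsupport u, a ≤ p.1) (sw : ∀ p ∈ tsupport w, p.1 ≤ b)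
    (hcomp : ∀ s : ℝ, correlation g w (s, 0) = correlation u k (s, 0)) :
    correlation r w 0 + correlation u l 0 = 0 := by
  refine eq_zero_of_tensor_test (A := fun z => correlation u k z - correlation g w z)
    (B := fun z => correlation r w z + correlation u l z)
    ((continuous_correlation hu hk).sub (continuous_correlation hg hw))
    ((continuous_correlation hr hw).add (continuous_correlation hu hl))
    (fun s => by rw [hcomp, sub_self]) fun α β hα hαs hα0 hβ hβs => ?_
  set ρ : ℝ × V3 → ℝ := fun z => α z.1 * β z.2 with hρdef
  have hρ : ContDiff ℝ ∞ ρ := (hα.comp contDiff_fst).mul (hβ.comp contDiff_snd)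
  have hsub : tsupport ρ ⊆ tsupport α ×ˢ tsupport β := by
    refine closure_minimal (fun z hz => ?_)
      ((isClosed_tsupport α).prod (isClosed_tsupport β))
    have hz' : α z.1 * β z.2 ≠ 0 := hz
    exact ⟨subset_tsupport _ (left_ne_zero_of_mul hz'), subset_tsupport _ (right_ne_zero_of_mul hz')⟩
  have hρs : HasCompactSupport ρ :=
    (hαs.isCompact.prod hβs.isCompact).of_isClosed_subset (isClosed_tsupport _) hsub
  set ρ' : ℝ × V3 → ℝ := fun z => ρ (-z) with hρ'def
  have hρ' : ContDiff ℝ ∞ ρ' := hρ.comp contDiff_neg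
  have hρ's : HasCompactSupport ρ' := hρs.comp_homeomorph (Homeomorph.neg (ℝ × V3))
  have hts' : ∀ z ∈ tsupport ρ', -z ∈ tsupport ρ := fun z hz =>
    tsupport_comp_subset_preimage ρ continuous_neg hz
  have hd' : ∀ z v, fderiv ℝ ρ' z v = -fderiv ℝ ρ (-z) v := by
    intro z v
    have h1 : HasFDerivAt ρ' ((fderiv ℝ ρ (-z)).comp (-ContinuousLinearMap.id ℝ (ℝ × V3))) z :=
      ((hρ.differentiable (by simp) (-z)).hasFDerivAt).comp z (hasFDerivAt_id z).neg
    rw [h1.fderiv]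
    simp
  -- `ρ` lives at times `< 0` and `w` at times `≤ b`, so `ρ ⋆ w` ends strictly before `b`. In the
  -- same way `ρ' ⋆ u` begins strictly after `a`.
  have e1 := Hu.correlation hg hu hr hρ hρs hw cw fun z hz y hy => by
    have h1 : z.1 < 0 := hα0 (hsub hz).1
    have h2 := sw y hy
    simp only [mem_Iio]
    linarith
  have e2 := Hw.correlation hk hw hl hρ' hρ's hu cu fun z hz y hy => by
    have h1 : (-z).1 < 0 := hα0 (hsub (hts' z hz)).1
    have h2 := su y hy
    simp only [Prod.fst_neg] at h1
    simp only [mem_Ioi]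
    linarith
  have flip : ∀ (φ : ℝ × V3 → ℝ) (f h : ℝ × V3 → V6),
      ∫ z, φ (-z) * correlation f h z = ∫ z, φ z * correlation h f z := by
    intro φ f h
    rw [← integral_neg_eq_self (fun z => φ z * correlation h f z) volume]
    simp_rw [correlation_swap]
  have hsym : ∀ i z, correlation (fun p => symbol i (u p)) w z
      = correlation u (fun p => symbol i (w p)) z := fun i z =>
    integral_congr_ae (Eventually.of_forall fun p => inner_symbol i _ _)
  -- Reflecting `z` brings the second equation to the kernel `ρ` and to correlations in the order of
  -- the first. Its derivative terms acquire a minus sign, so the spatial sums are opposite.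
  simp only [hd', neg_mul, integral_neg, Finset.sum_neg_distrib] at e2
  simp only [fun v => flip (fun z => fderiv ℝ ρ z v), flip ρ, hsym, hρ'def] at e2
  have hdt : ∀ z : ℝ × V3, deriv α z.1 * β z.2 = fderiv ℝ ρ z (1, 0) := fun z =>
    (fderiv_tensor hα hβ z).symm
  have hdc : Continuous fun z => fderiv ℝ ρ z (1, 0) :=
    (hρ.continuous_fderiv (by simp)).clm_apply continuous_const
  have hint : ∀ {φ ψ : ℝ × V3 → ℝ}, Continuous φ → HasCompactSupport φ → Continuous ψ →
      Integrable fun z => φ z * ψ z := fun h1 h2 h3 =>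
    (h1.mul h3).integrable_of_hasCompactSupport h2.mul_right
  change ∫ z : ℝ × V3, deriv α z.1 * β z.2 * _ = ∫ z, ρ z * _
  simp only [hdt, mul_sub, mul_add]
  rw [integral_sub (hint hdc (hρs.fderiv_apply ℝ _) (continuous_correlation hu hk))
      (hint hdc (hρs.fderiv_apply ℝ _) (continuous_correlation hg hw)),
    integral_add (hint hρ.continuous hρs (continuous_correlation hr hw))
      (hint hρ.continuous hρs (continuous_correlation hu hl))]
  linarith

/-! ### Spatial cutoffs, and Green's formula without compact supports -/

theorem memLp_smul_of_bdd {α : Type*} [MeasurableSpace α] {m : Measure α} {χ : α → ℝ}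
    (hχ : AEStronglyMeasurable χ m) {C : ℝ} (hC : ∀ p, |χ p| ≤ C) {u : α → V6}
    (hu : MemLp u 2 m) : MemLp (fun p => χ p • u p) 2 m := by
  refine hu.of_le_mul (c := C) (hχ.smul hu.1) (Eventually.of_forall fun p => ?_)
  rw [norm_smul]
  exact mul_le_mul_of_nonneg_right (hC p) (norm_nonneg _)

/-- A sequence of cutoff functions in space. -/
def spaceCutoff (n : ℕ) (p : ℝ × V3) : ℝ :=
  (⟨1, 2, one_pos, one_lt_two⟩ : ContDiffBump (0 : V3)) (((n : ℝ) + 1)⁻¹ • p.2)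

theorem contDiff_spaceCutoff (n : ℕ) : ContDiff ℝ ∞ (spaceCutoff n) :=
  (ContDiffBump.contDiff _).comp (contDiff_snd.const_smul _)

theorem spaceCutoff_abs_le (n : ℕ) (p : ℝ × V3) : |spaceCutoff n p| ≤ 1 := by
  rw [spaceCutoff, abs_of_nonneg (ContDiffBump.nonneg _)]
  exact ContDiffBump.le_one _

theorem spaceCutoff_eq_zero {n : ℕ} {p : ℝ × V3} (h : 2 * ((n : ℝ) + 1) < ‖p.2‖) :
    spaceCutoff n p = 0 := by
  have hn : (0 : ℝ) < (n : ℝ) + 1 := by positivity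
  refine ContDiffBump.zero_of_le_dist _ ?_
  rw [dist_zero_right, norm_smul, Real.norm_of_nonneg (inv_nonneg.mpr hn.le)]
  rw [inv_mul_eq_div, le_div_iff₀ hn]
  exact h.le

theorem tendsto_spaceCutoff (p : ℝ × V3) :
    Tendsto (fun n => spaceCutoff n p) atTop (𝓝 1) := by
  refine tendsto_const_nhds.congr' ?_
  obtain ⟨N, hN⟩ := exists_nat_ge ‖p.2‖
  filter_upwards [eventually_ge_atTop N] with n hn
  have hn0 : (0 : ℝ) < (n : ℝ) + 1 := by positivity
  refine (ContDiffBump.one_of_mem_closedBall _ ?_).symm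
  rw [mem_closedBall_zero_iff, norm_smul, Real.norm_of_nonneg (inv_nonneg.mpr hn0.le),
    inv_mul_eq_div, div_le_one hn0]
  have : (N : ℝ) ≤ n := by exact_mod_cast hn
  linarith

/-- The cutoff is a fixed bump stretched by the factor `n + 1`, so its gradient shrinks by that
factor. Only `v.2` enters because the cutoff is constant in time. -/
theorem exists_fderiv_spaceCutoff_le : ∃ C : ℝ, 0 ≤ C ∧ ∀ (n : ℕ) (p v : ℝ × V3),
    |fderiv ℝ (spaceCutoff n) p v| ≤ C * ((n : ℝ) + 1)⁻¹ * ‖v.2‖ := by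
  let f : ContDiffBump (0 : V3) := ⟨1, 2, one_pos, one_lt_two⟩
  have hf : ContDiff ℝ ∞ f := f.contDiff
  obtain ⟨C, hC⟩ := (f.hasCompactSupport.fderiv ℝ).exists_bound_of_continuous
    (hf.continuous_fderiv (by simp))
  refine ⟨C, (norm_nonneg _).trans (hC 0), fun n p v => ?_⟩
  have hn : (0 : ℝ) ≤ ((n : ℝ) + 1)⁻¹ := by positivity
  have h1 : HasFDerivAt (fun p : ℝ × V3 => ((n : ℝ) + 1)⁻¹ • p.2)
      (((n : ℝ) + 1)⁻¹ • ContinuousLinearMap.snd ℝ ℝ V3) p := hasFDerivAt_snd.fun_const_smul _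
  have h2 : HasFDerivAt (spaceCutoff n) ((fderiv ℝ f (((n : ℝ) + 1)⁻¹ • p.2)).comp
      (((n : ℝ) + 1)⁻¹ • ContinuousLinearMap.snd ℝ ℝ V3)) p :=
    (hf.differentiable (by simp) _).hasFDerivAt.comp p h1
  rw [h2.fderiv]
  simp only [ContinuousLinearMap.comp_apply, smul_apply, map_smul,
    ContinuousLinearMap.coe_snd', smul_eq_mul, abs_mul, abs_of_nonneg hn]
  calc ((n : ℝ) + 1)⁻¹ * |fderiv ℝ f (((n : ℝ) + 1)⁻¹ • p.2) v.2|
      ≤ ((n : ℝ) + 1)⁻¹ * (C * ‖v.2‖) := by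
        refine mul_le_mul_of_nonneg_left ?_ hn
        exact ((fderiv ℝ f _).le_opNorm _).trans
          (mul_le_mul_of_nonneg_right (hC _) (norm_nonneg _))
    _ = _ := by ring

theorem exists_gradSymbol_spaceCutoff_le : ∃ C : ℝ, 0 ≤ C ∧ ∀ (n : ℕ) (p : ℝ × V3) (v : V6),
    ‖gradSymbol (spaceCutoff n) p v‖ ≤ C * ((n : ℝ) + 1)⁻¹ * ‖v‖ := by
  obtain ⟨C, hC, h⟩ := exists_fderiv_spaceCutoff_le
  refine ⟨C * ∑ i, ‖symbol i‖, by positivity, fun n p v => ?_⟩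
  have hn : (0 : ℝ) ≤ ((n : ℝ) + 1)⁻¹ := by positivity
  calc ‖gradSymbol (spaceCutoff n) p v‖
      ≤ ∑ i, C * ((n : ℝ) + 1)⁻¹ * (‖symbol i‖ * ‖v‖) := by
        refine norm_sum_le_of_le _ fun i _ => ?_
        rw [norm_smul]
        refine mul_le_mul ?_ ((symbol i).le_opNorm v) (norm_nonneg _) (by positivity)
        simpa using h n p (0, EuclideanSpace.single i 1)
    _ = _ := by
        rw [← Finset.mul_sum, ← Finset.sum_mul]
        ring

theorem memLp_gradSymbol_spaceCutoff (n : ℕ) {u : ℝ × V3 → V6} (hu : MemLp u 2) :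
    MemLp (fun p => gradSymbol (spaceCutoff n) p (u p)) 2 := by
  obtain ⟨C, hC, h⟩ := exists_gradSymbol_spaceCutoff_le
  refine hu.of_le_mul (c := C * ((n : ℝ) + 1)⁻¹) ?_ (Eventually.of_forall fun p => h n p (u p))
  refine Finset.aestronglyMeasurable_fun_sum _ fun i _ => ?_
  have hd : Continuous fun p => fderiv ℝ (spaceCutoff n) p (0, EuclideanSpace.single i 1) :=
    ((contDiff_spaceCutoff n).continuous_fderiv (by simp)).clm_apply continuous_const
  exact hd.aestronglyMeasurable.smul ((symbol i).continuous.comp_aestronglyMeasurable hu.1)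

theorem fderiv_spaceCutoff_time (n : ℕ) (p : ℝ × V3) :
    fderiv ℝ (spaceCutoff n) p (1, 0) = 0 := by
  obtain ⟨C, hC, h⟩ := exists_fderiv_spaceCutoff_le
  have := h n p (1, 0)
  rw [norm_zero, mul_zero] at this
  exact abs_eq_zero.mp (le_antisymm this (abs_nonneg _))

theorem tsupport_spaceCutoff_smul_subset {a b : ℝ} {u : ℝ × V3 → V6}
    (su : ∀ p, u p ≠ 0 → p.1 ∈ Icc a b) (n : ℕ) :
    tsupport (fun p => spaceCutoff n p • u p)
      ⊆ Icc a b ×ˢ Metric.closedBall (0 : V3) (2 * ((n : ℝ) + 1)) := by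
  refine closure_minimal (fun p hp => ?_) (isClosed_Icc.prod Metric.isClosed_closedBall)
  have hp' : spaceCutoff n p • u p ≠ 0 := hp
  refine ⟨su p (right_ne_zero_of_smul hp'), ?_⟩
  rw [mem_closedBall_zero_iff]
  by_contra! hcon
  exact left_ne_zero_of_smul hp' (spaceCutoff_eq_zero hcon)

theorem hasCompactSupport_spaceCutoff_smul {a b : ℝ} {u : ℝ × V3 → V6}
    (su : ∀ p, u p ≠ 0 → p.1 ∈ Icc a b) (n : ℕ) :
    HasCompactSupport (fun p => spaceCutoff n p • u p) :=
  (isCompact_Icc.prod (isCompact_closedBall _ _)).of_isClosed_subset (isClosed_tsupport _)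
    (tsupport_spaceCutoff_smul_subset su n)

/-- The cutoff source of `WeakSystem.smul` for `spaceCutoff n`. -/
def cutSource (n : ℕ) (u r : ℝ × V3 → V6) (p : ℝ × V3) : V6 :=
  spaceCutoff n p • r p - gradSymbol (spaceCutoff n) p (u p)

theorem memLp_spaceCutoff_smul (n : ℕ) {u : ℝ × V3 → V6} (hu : MemLp u 2) :
    MemLp (fun p => spaceCutoff n p • u p) 2 :=
  memLp_smul_of_bdd (contDiff_spaceCutoff n).continuous.aestronglyMeasurable
    (spaceCutoff_abs_le n) hu

theorem memLp_cutSource (n : ℕ) {u r : ℝ × V3 → V6} (hu : MemLp u 2) (hr : MemLp r 2) :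
    MemLp (cutSource n u r) 2 :=
  (memLp_spaceCutoff_smul n hr).sub (memLp_gradSymbol_spaceCutoff n hu)

theorem WeakSystem.spaceCutoff_smul {I : Set ℝ} {g u r : ℝ × V3 → V6} (H : WeakSystem I g u r)
    (hg : MemLp g 2) (hu : MemLp u 2) (hr : MemLp r 2) (n : ℕ) :
    WeakSystem I (fun p => spaceCutoff n p • g p) (fun p => spaceCutoff n p • u p)
      (cutSource n u r) := by
  have := H.smul (J := I) hg hu hr (contDiff_spaceCutoff n) fun _ _ h => h
  simp only [fderiv_spaceCutoff_time, zero_smul, add_zero] at this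
  exact this

/-- Dominated convergence: the cutoffs tend to `1`, and the commutator term is of order `1 / (n +
1)`. -/
theorem tendsto_integral_inner_cutSource {u r w : ℝ × V3 → V6} (hu : MemLp u 2) (hr : MemLp r 2)
    (hw : MemLp w 2) :
    Tendsto (fun n => ∫ p, ⟪cutSource n u r p, spaceCutoff n p • w p⟫_ℝ) atTop
      (𝓝 (∫ p, ⟪r p, w p⟫_ℝ)) := by
  obtain ⟨C, hC, h⟩ := exists_gradSymbol_spaceCutoff_le
  refine tendsto_integral_of_dominated_convergence
    (fun p => ‖r p‖ * ‖w p‖ + C * (‖u p‖ * ‖w p‖))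
    (fun n => ((memLp_cutSource n hu hr).integrable_inner_two (memLp_spaceCutoff_smul n hw)).1)
    ((hr.norm.integrable_mul hw.norm).add ((hu.norm.integrable_mul hw.norm).const_mul C))
    (fun n => Eventually.of_forall fun p => ?_) (Eventually.of_forall fun p => ?_)
  · have h1 : ‖cutSource n u r p‖ ≤ ‖r p‖ + C * ‖u p‖ := by
      refine (norm_sub_le _ _).trans (add_le_add ?_ ((h n p (u p)).trans ?_))
      · rw [norm_smul]
        exact mul_le_of_le_one_left (norm_nonneg _) (spaceCutoff_abs_le n p)
      · refine mul_le_mul_of_nonneg_right (mul_le_of_le_one_right hC ?_) (norm_nonneg _)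
        exact inv_le_one_of_one_le₀ (by linarith [n.cast_nonneg (α := ℝ)])
    have h2 : ‖spaceCutoff n p • w p‖ ≤ ‖w p‖ := by
      rw [norm_smul]
      exact mul_le_of_le_one_left (norm_nonneg _) (spaceCutoff_abs_le n p)
    calc ‖⟪cutSource n u r p, spaceCutoff n p • w p⟫_ℝ‖
        ≤ ‖cutSource n u r p‖ * ‖spaceCutoff n p • w p‖ := norm_inner_le_norm _ _
      _ ≤ (‖r p‖ + C * ‖u p‖) * ‖w p‖ :=
          mul_le_mul h1 h2 (norm_nonneg _) ((norm_nonneg _).trans h1)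
      _ = _ := by ring
  · have hG : Tendsto (fun n => gradSymbol (spaceCutoff n) p (u p)) atTop (𝓝 0) := by
      refine squeeze_zero_norm (fun n => h n p (u p)) ?_
      have : Tendsto (fun n : ℕ => ((n : ℝ) + 1)⁻¹) atTop (𝓝 0) := by
        simpa only [one_div] using tendsto_one_div_add_atTop_nhds_zero_nat (𝕜 := ℝ)
      simpa using (this.const_mul C).mul_const ‖u p‖
    have h1 := ((tendsto_spaceCutoff p).smul_const (r p)).sub hG
    have h2 := (tendsto_spaceCutoff p).smul_const (w p)
    simpa using! h1.inner h2

/-- Green's formula for a forward solution `u` and a backward solution `w`. -/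
theorem pairing {a b : ℝ} {g u r k w l : ℝ × V3 → V6}
    (Hu : WeakSystem (Iio b) g u r) (Hw : WeakSystem (Ioi a) k w l)
    (hg : MemLp g 2) (hu : MemLp u 2) (hr : MemLp r 2)
    (hk : MemLp k 2) (hw : MemLp w 2) (hl : MemLp l 2)
    (su : ∀ p, u p ≠ 0 → p.1 ∈ Icc a b) (sw : ∀ p, w p ≠ 0 → p.1 ∈ Icc a b)
    (hcomp : ∀ (p : ℝ × V3) (s : ℝ), ⟪g p, w (p - (s, 0))⟫_ℝ = ⟪u p, k (p - (s, 0))⟫_ℝ) :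
    (∫ p, ⟪r p, w p⟫_ℝ) + ∫ p, ⟪u p, l p⟫_ℝ = 0 := by
  -- The fields are bounded in time already, so a spatial cutoff gives compact support. The same
  -- cutoff is used for both solutions, which preserves `hcomp`.
  have key : ∀ n, (∫ p, ⟪cutSource n u r p, spaceCutoff n p • w p⟫_ℝ)
      + ∫ p, ⟪cutSource n w l p, spaceCutoff n p • u p⟫_ℝ = 0 := by
    intro n
    have := pairing_of_hasCompactSupport (Hu.spaceCutoff_smul hg hu hr n)
      (Hw.spaceCutoff_smul hk hw hl n) (memLp_spaceCutoff_smul n hg) (memLp_spaceCutoff_smul n hu)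
      (memLp_cutSource n hu hr) (memLp_spaceCutoff_smul n hk) (memLp_spaceCutoff_smul n hw)
      (memLp_cutSource n hw hl) (hasCompactSupport_spaceCutoff_smul su n)
      (hasCompactSupport_spaceCutoff_smul sw n)
      (fun p hp => (tsupport_spaceCutoff_smul_subset su n hp).1.1)
      (fun p hp => (tsupport_spaceCutoff_smul_subset sw n hp).1.2)
      (fun s => integral_congr_ae (Eventually.of_forall fun p => by
        simp only [inner_smul_left, inner_smul_right, hcomp]))
    simp only [correlation, sub_zero] at this
    rw [← this]
    congr 1
    exact integral_congr_ae (Eventually.of_forall fun p => real_inner_comm _ _)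
  have h1 := (tendsto_integral_inner_cutSource hu hr hw).add
    (tendsto_integral_inner_cutSource hw hl hu)
  simp only [key] at h1
  have h2 := tendsto_nhds_unique h1 tendsto_const_nhds
  rw [← h2]
  congr 1
  exact integral_congr_ae (Eventually.of_forall fun p => real_inner_comm _ _)

/-! ### Time reversal of weak solutions -/

/-- Change of sign of the electric component. -/
def flipE : V6 →L[ℝ] V6 :=
  (WithLp.prodContinuousLinearEquiv 2 ℝ V3 V3).symm.toContinuousLinearMap ∘L
    ((-WithLp.fstL 2 ℝ V3 V3).prod (WithLp.sndL 2 ℝ V3 V3))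

theorem inner_flipE (v w : V6) : ⟪flipE v, w⟫_ℝ = ⟪v, flipE w⟫_ℝ := by
  change ⟪-v.fst, w.fst⟫_ℝ + ⟪v.snd, w.snd⟫_ℝ = ⟪v.fst, -w.fst⟫_ℝ + ⟪v.snd, w.snd⟫_ℝ
  rw [inner_neg_left, inner_neg_right]

theorem flipE_flipE (v : V6) : flipE (flipE v) = v := by
  change WithLp.toLp 2 (- -v.fst, v.snd) = v
  rw [neg_neg]
  rfl

/-- The curls exchange the electric and magnetic parts, so a sign change of one part reverses the
spatial operator, just as `t ↦ 2T - t` reverses `∂ₜ`. The conductivity term keeps its sign relative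
to the source, which is why reversal leads to the adjoint equation. -/
theorem symbol_flipE (i : Fin 3) (v : V6) : symbol i (flipE v) = -flipE (symbol i v) := by
  change WithLp.toLp 2 (axisCross i v.snd, -axisCross i (-v.fst))
    = WithLp.toLp 2 (- -axisCross i v.snd, - -axisCross i v.fst)
  rw [map_neg, neg_neg, neg_neg]

/-- The reflection `t ↦ 2T - t` of space-time. -/
def reflectTime (T : ℝ) : ℝ × V3 ≃ₜ ℝ × V3 :=
  (Homeomorph.subLeft (2 * T)).prodCongr (Homeomorph.refl V3)

theorem reflectTime_apply (T : ℝ) (p : ℝ × V3) : reflectTime T p = (2 * T - p.1, p.2) := rfl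

theorem reflectTime_reflectTime (T : ℝ) (p : ℝ × V3) : reflectTime T (reflectTime T p) = p := by
  simp [reflectTime_apply]

theorem measurePreserving_reflectTime (T : ℝ) :
    MeasurePreserving (reflectTime T) volume volume :=
  (Measure.measurePreserving_sub_left (volume : Measure ℝ) (2 * T)).prod
    (MeasurePreserving.id (volume : Measure V3))

theorem integral_reflectTime (T : ℝ) (f : ℝ × V3 → ℝ) :
    ∫ p, f (reflectTime T p) = ∫ p, f p :=
  (measurePreserving_reflectTime T).integral_comp (reflectTime T).measurableEmbedding f

theorem reverseFun_apply (T : ℝ) (q : ℝ × V3 → V6) (p : ℝ × V3) :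
    reverseFun T q p = flipE (q (reflectTime T p)) := rfl

theorem fderiv_comp_reflectTime {F : Type*} [NormedAddCommGroup F] [NormedSpace ℝ F] {T : ℝ}
    {w : ℝ × V3 → F} (hw : ContDiff ℝ ∞ w) (A : F →L[ℝ] F) (p v : ℝ × V3) :
    fderiv ℝ (fun p => A (w (reflectTime T p))) p v
      = A (fderiv ℝ w (reflectTime T p) (-v.1, v.2)) := by
  have hR : HasFDerivAt (reflectTime T) ((-ContinuousLinearMap.fst ℝ ℝ V3).prod
      (ContinuousLinearMap.snd ℝ ℝ V3)) p :=
    (hasFDerivAt_fst.const_sub (2 * T)).prodMk hasFDerivAt_snd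
  have h : HasFDerivAt (fun p => A (w (reflectTime T p))) _ p := A.hasFDerivAt.comp p
    ((hw.differentiable (by simp) (reflectTime T p)).hasFDerivAt.comp p hR)
  rw [h.fderiv]
  rfl

theorem fderiv_reverseFun {T : ℝ} {w : ℝ × V3 → V6} (hw : ContDiff ℝ ∞ w) (p v : ℝ × V3) :
    fderiv ℝ (reverseFun T w) p v = flipE (fderiv ℝ w (reflectTime T p) (-v.1, v.2)) :=
  fderiv_comp_reflectTime hw flipE p v

theorem contDiff_reverseFun {T : ℝ} {w : ℝ × V3 → V6} (hw : ContDiff ℝ ∞ w) :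
    ContDiff ℝ ∞ (reverseFun T w) := by
  have h1 : ContDiff ℝ ∞ (reflectTime T) := by
    change ContDiff ℝ ∞ fun p : ℝ × V3 => (2 * T - p.1, p.2)
    fun_prop
  exact flipE.contDiff.comp (hw.comp h1)

theorem IsTest.reverse {T : ℝ} {I J : Set ℝ} {w : ℝ × V3 → V6} (hw : IsTest I w)
    (hIJ : ∀ t, 2 * T - t ∈ I → t ∈ J) : IsTest J (reverseFun T w) := by
  have hsub : tsupport (reverseFun T w) ⊆ tsupport (w ∘ reflectTime T) :=
    tsupport_comp_subset (map_zero flipE) _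
  refine ⟨contDiff_reverseFun hw.contDiff, ?_, fun p hp => hIJ _ ?_⟩
  · exact (hw.hasCompactSupport.comp_homeomorph (reflectTime T)).of_isClosed_subset
      (isClosed_tsupport _) hsub
  · exact hw.mem _ (tsupport_comp_subset_preimage w (reflectTime T).continuous (hsub hp))

theorem tDeriv_reverseFun {T : ℝ} {w : ℝ × V3 → V6} (hw : ContDiff ℝ ∞ w) (p : ℝ × V3) :
    tDeriv (reverseFun T w) p = -flipE (tDeriv w (reflectTime T p)) := by
  rw [tDeriv, fderiv_reverseFun hw, tDeriv, ← map_neg, ← map_neg]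
  simp

theorem spaceOp_reverseFun {T : ℝ} {w : ℝ × V3 → V6} (hw : ContDiff ℝ ∞ w) (p : ℝ × V3) :
    spaceOp (reverseFun T w) p = -flipE (spaceOp w (reflectTime T p)) := by
  simp only [spaceOp, fderiv_reverseFun hw, neg_zero, symbol_flipE, map_sum,
    Finset.sum_neg_distrib]

/-- Test the original system with the reversed test field. Both derivative terms change sign, which
is absorbed into the source; the reflected time condition turns zero initial values into zero final
values. -/
theorem WeakSystem.reverse {T : ℝ} {I J : Set ℝ} {g u r : ℝ × V3 → V6} (H : WeakSystem I g u r)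
    (hIJ : ∀ t, 2 * T - t ∈ J → t ∈ I) :
    WeakSystem J (reverseFun T g) (reverseFun T u) (fun p => -reverseFun T r p) := by
  intro w hw
  have h := H _ (hw.reverse hIJ)
  rw [← integral_reflectTime T, ← integral_reflectTime T fun p => ⟪r p, _⟫_ℝ] at h
  simp only [tDeriv_reverseFun hw.contDiff, spaceOp_reverseFun hw.contDiff, reverseFun_apply,
    reflectTime_reflectTime, inner_neg_right, ← inner_flipE] at h
  simp only [reverseFun_apply, inner_neg_left, integral_neg, ← h]
  rw [← integral_neg]
  refine integral_congr_ae (Eventually.of_forall fun p => ?_)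
  ring

/-! ### Block diagonal multiplication operators -/

theorem matVec_add (A : Matrix (Fin 3) (Fin 3) ℝ) (v w : V3) :
    matVec A (v + w) = matVec A v + matVec A w := by
  simp [matVec, Matrix.mulVec_add]

theorem matVec_smul (A : Matrix (Fin 3) (Fin 3) ℝ) (c : ℝ) (v : V3) :
    matVec A (c • v) = c • matVec A v := by
  simp [matVec, Matrix.mulVec_smul]

theorem matVec_neg (A : Matrix (Fin 3) (Fin 3) ℝ) (v : V3) : matVec A (-v) = -matVec A v := by
  simp [matVec, Matrix.mulVec_neg]

theorem zero_matVec (v : V3) : matVec 0 v = 0 := by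
  simp [matVec]

theorem inner_matVec {A : Matrix (Fin 3) (Fin 3) ℝ} (hA : A.IsSymm) (v w : V3) :
    ⟪matVec A v, w⟫_ℝ = ⟪v, matVec A w⟫_ℝ := by
  simp only [matVec, EuclideanSpace.inner_eq_star_dotProduct, star_trivial]
  rw [Matrix.dotProduct_mulVec, ← Matrix.mulVec_transpose, hA.eq, dotProduct_comm]

/-- Multiplication by `diag(A, B)`. -/
def blockVec (A B : Matrix (Fin 3) (Fin 3) ℝ) (v : V6) : V6 :=
  WithLp.toLp 2 (matVec A v.fst, matVec B v.snd)

theorem blockFun_apply (A B : V3 → Matrix (Fin 3) (Fin 3) ℝ) (u : ℝ × V3 → V6) (p : ℝ × V3) :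
    blockFun A B u p = blockVec (A p.2) (B p.2) (u p) := rfl

section blockVec

variable (A B : Matrix (Fin 3) (Fin 3) ℝ)

theorem blockVec_add (v w : V6) : blockVec A B (v + w) = blockVec A B v + blockVec A B w := by
  change WithLp.toLp 2 (matVec A (v.fst + w.fst), matVec B (v.snd + w.snd)) = _
  rw [matVec_add, matVec_add]
  rfl

theorem blockVec_smul (c : ℝ) (v : V6) : blockVec A B (c • v) = c • blockVec A B v := by
  change WithLp.toLp 2 (matVec A (c • v.fst), matVec B (c • v.snd)) = _
  rw [matVec_smul, matVec_smul]
  rfl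

theorem blockVec_zero : blockVec A B 0 = 0 := by
  have := blockVec_smul A B 0 0
  simpa only [zero_smul] using this

theorem blockVec_flipE (v : V6) : blockVec A B (flipE v) = flipE (blockVec A B v) := by
  change WithLp.toLp 2 (matVec A (-v.fst), matVec B v.snd)
    = WithLp.toLp 2 (-matVec A v.fst, matVec B v.snd)
  rw [matVec_neg]

variable {A B}

theorem inner_blockVec (hA : A.IsSymm) (hB : B.IsSymm) (v w : V6) :
    ⟪blockVec A B v, w⟫_ℝ = ⟪v, blockVec A B w⟫_ℝ := by
  change ⟪matVec A v.fst, w.fst⟫_ℝ + ⟪matVec B v.snd, w.snd⟫_ℝ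
    = ⟪v.fst, matVec A w.fst⟫_ℝ + ⟪v.snd, matVec B w.snd⟫_ℝ
  rw [inner_matVec hA, inner_matVec hB]

end blockVec

variable {Ω : Set V3} {a b : ℝ}

theorem ae_mem_cyl (hΩ : MeasurableSet Ω) : ∀ᵐ p ∂(cylMeasure Ω a b), p ∈ Icc a b ×ˢ Ω :=
  ae_restrict_mem (measurableSet_Icc.prod hΩ)

theorem memLp_blockFun_of_memLp (hΩ : MeasurableSet Ω)
    {A B : V3 → Matrix (Fin 3) (Fin 3) ℝ} (hA : IsBddMeas Ω A) (hB : IsBddMeas Ω B)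
    {v : ℝ × V3 → V6} (hv : MemLp v 2 (cylMeasure Ω a b)) :
    MemLp (blockFun A B v) 2 (cylMeasure Ω a b) := by
  refine (memLp_blockFun hΩ hA hB (hv.toLp v)).ae_eq ?_
  filter_upwards [hv.coeFn_toLp] with p hp
  rw [blockFun_apply, blockFun_apply, hp]

theorem coeFn_blockMul (hΩ : IsOpen Ω) {A B : V3 → Matrix (Fin 3) (Fin 3) ℝ}
    (hA : IsBddMeas Ω A) (hB : IsBddMeas Ω B) (u : FieldSpace Ω a b) :
    blockMul hΩ hA hB u =ᵐ[cylMeasure Ω a b] blockFun A B u :=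
  MemLp.coeFn_toLp _

theorem inner_eq_integral (u v : FieldSpace Ω a b) :
    ⟪u, v⟫_ℝ = ∫ p, ⟪u p, v p⟫_ℝ ∂(cylMeasure Ω a b) := L2.inner_def u v

theorem inner_blockMul (hΩ : IsOpen Ω) {A B : V3 → Matrix (Fin 3) (Fin 3) ℝ}
    (hA : IsBddMeas Ω A) (hB : IsBddMeas Ω B) (sA : ∀ x ∈ Ω, (A x).IsSymm)
    (sB : ∀ x ∈ Ω, (B x).IsSymm) (u v : FieldSpace Ω a b) :
    ⟪blockMul hΩ hA hB u, v⟫_ℝ = ⟪u, blockMul hΩ hA hB v⟫_ℝ := by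
  rw [inner_eq_integral, inner_eq_integral]
  refine integral_congr_ae ?_
  filter_upwards [coeFn_blockMul hΩ hA hB u, coeFn_blockMul hΩ hA hB v,
    ae_mem_cyl hΩ.measurableSet] with p h1 h2 h3
  rw [h1, h2, blockFun_apply, blockFun_apply, inner_blockVec (sA _ h3.2) (sB _ h3.2)]

/-- Multiplication by a symmetric block diagonal field, as a continuous linear operator. -/
def blockMulL (hΩ : IsOpen Ω) {A B : V3 → Matrix (Fin 3) (Fin 3) ℝ}
    (hA : IsBddMeas Ω A) (hB : IsBddMeas Ω B) (sA : ∀ x ∈ Ω, (A x).IsSymm)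
    (sB : ∀ x ∈ Ω, (B x).IsSymm) : FieldSpace Ω a b →L[ℝ] FieldSpace Ω a b :=
  let L : FieldSpace Ω a b →ₗ[ℝ] FieldSpace Ω a b :=
    { toFun := blockMul hΩ hA hB
      map_add' := fun u v => by
        refine Lp.ext ?_
        filter_upwards [coeFn_blockMul hΩ hA hB (u + v), coeFn_blockMul hΩ hA hB u,
          coeFn_blockMul hΩ hA hB v, Lp.coeFn_add u v,
          Lp.coeFn_add (blockMul hΩ hA hB u) (blockMul hΩ hA hB v)] with p h1 h2 h3 h4 h5
        rw [h1, h5, Pi.add_apply, h2, h3, blockFun_apply, h4, Pi.add_apply, blockVec_add]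
        rfl
      map_smul' := fun c u => by
        refine Lp.ext ?_
        filter_upwards [coeFn_blockMul hΩ hA hB (c • u), coeFn_blockMul hΩ hA hB u,
          Lp.coeFn_smul c u, Lp.coeFn_smul c (blockMul hΩ hA hB u)] with p h1 h2 h3 h4
        rw [h1, RingHom.id_apply, h4, Pi.smul_apply, h2, blockFun_apply, h3, Pi.smul_apply,
          blockVec_smul]
        rfl }
  -- Hellinger–Toeplitz: a symmetric operator defined on the whole Hilbert space is continuous.
  have hL : L.IsSymmetric := inner_blockMul hΩ hA hB sA sB
  ⟨L, hL.continuous⟩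

/-! ### Inversion of `Γ` and the energy inner product -/

theorem IsUnifPosDef.isUnit_det {A : V3 → Matrix (Fin 3) (Fin 3) ℝ} (hA : IsUnifPosDef Ω A)
    {x : V3} (hx : x ∈ Ω) : IsUnit (A x).det := by
  obtain ⟨-, c, hc, hcoer⟩ := hA
  rw [isUnit_iff_ne_zero]
  intro h0
  obtain ⟨v, hv, hv0⟩ := Matrix.exists_mulVec_eq_zero_iff.mpr h0
  have h1 := hcoer x hx (WithLp.toLp 2 v)
  have h2 : matVec (A x) (WithLp.toLp 2 v) = 0 := by
    simp [matVec, hv0]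
  rw [h2, inner_zero_left] at h1
  have h3 : 0 < ‖(WithLp.toLp 2 v : V3)‖ := by
    rw [norm_pos_iff]
    simpa using hv
  nlinarith [mul_pos hc (pow_pos h3 2)]

theorem matVec_matVec_inv {A : Matrix (Fin 3) (Fin 3) ℝ} (hA : IsUnit A.det) (v : V3) :
    matVec A (matVec A⁻¹ v) = v := by
  simp [matVec, Matrix.mulVec_mulVec, Matrix.mul_nonsing_inv _ hA]

theorem matVec_inv_matVec {A : Matrix (Fin 3) (Fin 3) ℝ} (hA : IsUnit A.det) (v : V3) :
    matVec A⁻¹ (matVec A v) = v := by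
  simp [matVec, Matrix.mulVec_mulVec, Matrix.nonsing_inv_mul _ hA]

namespace Medium

variable (M : Medium Ω)

theorem inv_symm {A : V3 → Matrix (Fin 3) (Fin 3) ℝ} (hA : IsUnifPosDef Ω A) :
    ∀ x ∈ Ω, ((A x)⁻¹).IsSymm := fun x hx => (hA.1 x hx).inv

theorem gamma_gammaInv (hΩ : IsOpen Ω) (u : FieldSpace Ω a b) :
    M.gamma hΩ (M.gammaInv hΩ u) = u := by
  refine Lp.ext ?_
  filter_upwards [coeFn_blockMul hΩ M.ε_bdd M.μ_bdd (M.gammaInv hΩ u),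
    coeFn_blockMul hΩ (M.ε_bdd.inv M.ε_pos) (M.μ_bdd.inv M.μ_pos) u,
    ae_mem_cyl hΩ.measurableSet] with p h1 h2 h3
  refine h1.trans ?_
  change blockVec _ _ (M.gammaInv hΩ u p) = _
  rw [show M.gammaInv hΩ u p = _ from h2]
  change WithLp.toLp 2 (matVec (M.ε p.2) (matVec (M.ε p.2)⁻¹ (u p).fst),
    matVec (M.μ p.2) (matVec (M.μ p.2)⁻¹ (u p).snd)) = u p
  rw [matVec_matVec_inv (M.ε_pos.isUnit_det h3.2), matVec_matVec_inv (M.μ_pos.isUnit_det h3.2)]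
  rfl

theorem gammaInv_gamma (hΩ : IsOpen Ω) (u : FieldSpace Ω a b) :
    M.gammaInv hΩ (M.gamma hΩ u) = u := by
  refine Lp.ext ?_
  filter_upwards [coeFn_blockMul hΩ (M.ε_bdd.inv M.ε_pos) (M.μ_bdd.inv M.μ_pos) (M.gamma hΩ u),
    coeFn_blockMul hΩ M.ε_bdd M.μ_bdd u,
    ae_mem_cyl hΩ.measurableSet] with p h1 h2 h3
  refine h1.trans ?_
  change blockVec _ _ (M.gamma hΩ u p) = _
  rw [show M.gamma hΩ u p = _ from h2]
  change WithLp.toLp 2 (matVec (M.ε p.2)⁻¹ (matVec (M.ε p.2) (u p).fst),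
    matVec (M.μ p.2)⁻¹ (matVec (M.μ p.2) (u p).snd)) = u p
  rw [matVec_inv_matVec (M.ε_pos.isUnit_det h3.2), matVec_inv_matVec (M.μ_pos.isUnit_det h3.2)]
  rfl

/-- `Γ` as a continuous linear operator. -/
def gammaL (hΩ : IsOpen Ω) : FieldSpace Ω a b →L[ℝ] FieldSpace Ω a b :=
  blockMulL hΩ M.ε_bdd M.μ_bdd M.ε_pos.1 M.μ_pos.1

/-- `Γ⁻¹` as a continuous linear operator. -/
def gammaInvL (hΩ : IsOpen Ω) : FieldSpace Ω a b →L[ℝ] FieldSpace Ω a b :=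
  blockMulL hΩ (M.ε_bdd.inv M.ε_pos) (M.μ_bdd.inv M.μ_pos) (inv_symm M.ε_pos) (inv_symm M.μ_pos)

theorem inner_gamma (hΩ : IsOpen Ω) (u v : FieldSpace Ω a b) :
    ⟪M.gamma hΩ u, v⟫_ℝ = ⟪u, M.gamma hΩ v⟫_ℝ :=
  inner_blockMul hΩ M.ε_bdd M.μ_bdd M.ε_pos.1 M.μ_pos.1 u v

/-- The symmetry of `Γ` lets it act on the second argument. The energy product is thereby reduced to
the plain `L²` product. -/
theorem energyInner_eq (hΩ : IsOpen Ω) (u v : FieldSpace Ω a b) :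
    M.energyInner u v = ⟪u, M.gamma hΩ v⟫_ℝ := by
  rw [← inner_gamma, inner_eq_integral]
  refine integral_congr_ae ?_
  filter_upwards [coeFn_blockMul hΩ M.ε_bdd M.μ_bdd u] with p h1
  rw [show M.gamma hΩ u p = _ from h1]
  rfl

end Medium

/-! ### Maxwell's equations as a single system -/

theorem isBddMeas_zero : IsBddMeas Ω (fun _ => 0) :=
  ⟨fun _ _ => measurable_const, 0, fun _ _ _ _ => by simp⟩

/-- The formal adjoint of Maxwell's operator. -/
def adjOp (M : Medium Ω) (w : ℝ × V3 → V6) (p : ℝ × V3) : V6 :=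
  spaceOp w p - blockFun M.ε M.μ (tDeriv w) p + blockFun M.σ (fun _ => 0) w p

theorem Medium.σ_symm (M : Medium Ω) {x : V3} (hx : x ∈ Ω) : (M.σ x).IsSymm := by
  have := (M.σ_nonneg x hx).isHermitian
  rw [Matrix.IsHermitian, Matrix.conjTranspose_eq_transpose_of_trivial] at this
  exact this

theorem isSymm_zero : (0 : Matrix (Fin 3) (Fin 3) ℝ).IsSymm := Matrix.isSymm_zero

theorem memLp_adjOp (hΩ : MeasurableSet Ω) (M : Medium Ω) {I : Set ℝ} {w : ℝ × V3 → V6}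
    (hw : IsTest I w) : MemLp (adjOp M w) 2 (cylMeasure Ω a b) :=
  ((hw.memLp_spaceOp.restrict _).sub
    (memLp_blockFun_of_memLp hΩ M.ε_bdd M.μ_bdd (hw.memLp_tDeriv.restrict _))).add
    (memLp_blockFun_of_memLp hΩ M.σ_bdd isBddMeas_zero (hw.memLp.restrict _))

theorem inner_adjOp (M : Medium Ω) (w : ℝ × V3 → V6) {p : ℝ × V3} (hp : p.2 ∈ Ω) (v : V6) :
    ⟪v, adjOp M w p⟫_ℝ = ⟪v, spaceOp w p⟫_ℝ - ⟪blockVec (M.ε p.2) (M.μ p.2) v, tDeriv w p⟫_ℝ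
      + ⟪blockVec (M.σ p.2) 0 v, w p⟫_ℝ := by
  rw [inner_blockVec (M.ε_pos.1 _ hp) (M.μ_pos.1 _ hp), inner_blockVec (M.σ_symm hp) isSymm_zero,
    adjOp, inner_add_right, inner_sub_right]
  rfl

/-- The field with electric part `η` and magnetic part `ζ`. -/
def pairField (η ζ : ℝ × V3 → V3) (p : ℝ × V3) : V6 := WithLp.toLp 2 (η p, ζ p)

theorem fderiv_clm_comp_apply {F G : Type*} [NormedAddCommGroup F] [NormedSpace ℝ F]
    [NormedAddCommGroup G] [NormedSpace ℝ G] (A : F →L[ℝ] G) {w : ℝ × V3 → F}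
    (hw : ContDiff ℝ ∞ w) (p v : ℝ × V3) :
    fderiv ℝ (fun p => A (w p)) p v = A (fderiv ℝ w p v) := by
  have h : HasFDerivAt (fun p => A (w p)) _ p :=
    A.hasFDerivAt.comp p (hw.differentiable (by simp) p).hasFDerivAt
  rw [h.fderiv]
  rfl

theorem contDiff_clm_comp {F G : Type*} [NormedAddCommGroup F] [NormedSpace ℝ F]
    [NormedAddCommGroup G] [NormedSpace ℝ G] (A : F →L[ℝ] G) {w : ℝ × V3 → F}
    (hw : ContDiff ℝ ∞ w) : ContDiff ℝ ∞ (fun p => A (w p)) :=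
  A.contDiff.comp hw

theorem fderiv_prodMk_apply {F G : Type*} [NormedAddCommGroup F] [NormedSpace ℝ F]
    [NormedAddCommGroup G] [NormedSpace ℝ G] {η : ℝ × V3 → F} {ζ : ℝ × V3 → G}
    (hη : ContDiff ℝ ∞ η) (hζ : ContDiff ℝ ∞ ζ) (p v : ℝ × V3) :
    fderiv ℝ (fun p => (η p, ζ p)) p v = (fderiv ℝ η p v, fderiv ℝ ζ p v) := by
  have h := (hη.differentiable (by simp) p).hasFDerivAt.prodMk
    (hζ.differentiable (by simp) p).hasFDerivAt
  rw [h.fderiv]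
  rfl

section pairField

variable {η ζ : ℝ × V3 → V3}

theorem contDiff_pairField (hη : ContDiff ℝ ∞ η) (hζ : ContDiff ℝ ∞ ζ) :
    ContDiff ℝ ∞ (pairField η ζ) :=
  contDiff_clm_comp (WithLp.prodContinuousLinearEquiv 2 ℝ V3 V3).symm.toContinuousLinearMap
    (hη.prodMk hζ)

theorem fderiv_pairField (hη : ContDiff ℝ ∞ η) (hζ : ContDiff ℝ ∞ ζ) (p v : ℝ × V3) :
    fderiv ℝ (pairField η ζ) p v = WithLp.toLp 2 (fderiv ℝ η p v, fderiv ℝ ζ p v) := by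
  have h := fderiv_clm_comp_apply
    (WithLp.prodContinuousLinearEquiv 2 ℝ V3 V3).symm.toContinuousLinearMap (hη.prodMk hζ) p v
  rw [fderiv_prodMk_apply hη hζ] at h
  exact h

theorem tDeriv_pairField (hη : ContDiff ℝ ∞ η) (hζ : ContDiff ℝ ∞ ζ) (p : ℝ × V3) :
    tDeriv (pairField η ζ) p = WithLp.toLp 2 (timeDeriv η p, timeDeriv ζ p) :=
  fderiv_pairField hη hζ p _

theorem curl_eq_sum (η : ℝ × V3 → V3) (p : ℝ × V3) :
    curl η p = ∑ i, axisCross i (fderiv ℝ η p (0, EuclideanSpace.single i 1)) := by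
  ext j
  simp only [curl, spaceDeriv, Fin.sum_univ_three, axisCross_apply, crossProduct]
  fin_cases j <;> simp <;> ring

theorem spaceOp_pairField (hη : ContDiff ℝ ∞ η) (hζ : ContDiff ℝ ∞ ζ) (p : ℝ × V3) :
    spaceOp (pairField η ζ) p = WithLp.toLp 2 (curl ζ p, -curl η p) := by
  simp only [spaceOp, fderiv_pairField hη hζ, curl_eq_sum, Fin.sum_univ_three]
  simp only [symbol_apply, ← WithLp.toLp_add, Prod.mk_add_mk, neg_add]
  rfl

theorem isTest_pairField (hη : IsTestField b η) (hζ : IsTestField b ζ) :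
    IsTest (Iio b) (pairField η ζ) := by
  have hsub : tsupport (pairField η ζ) ⊆ tsupport η ∪ tsupport ζ := by
    refine closure_minimal (fun p hp => ?_) ((isClosed_tsupport _).union (isClosed_tsupport _))
    by_contra hcon
    rw [mem_union, not_or] at hcon
    refine hp ?_
    rw [pairField, image_eq_zero_of_notMem_tsupport hcon.1,
      image_eq_zero_of_notMem_tsupport hcon.2]
    rfl
  refine ⟨contDiff_pairField hη.1 hζ.1, (hη.2.1.isCompact.union hζ.2.1.isCompact).of_isClosed_subset
    (isClosed_tsupport _) hsub, fun p hp => ?_⟩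
  exact (hsub hp).elim (hη.2.2 p) (hζ.2.2 p)

theorem isTestField_zero : IsTestField b 0 :=
  ⟨contDiff_const, HasCompactSupport.zero, fun p hp => by simp [tsupport] at hp⟩

theorem IsTest.isTestField {w : ℝ × V3 → V6} (hw : IsTest (Iio b) w) (A : V6 →L[ℝ] V3) :
    IsTestField b (fun p => A (w p)) :=
  ⟨contDiff_clm_comp A hw.contDiff, hw.hasCompactSupport.comp_left (map_zero A),
    fun p hp => hw.mem p (tsupport_comp_subset (map_zero A) w hp)⟩

theorem inner_adjOp_pairField (M : Medium Ω) (hη : ContDiff ℝ ∞ η) (hζ : ContDiff ℝ ∞ ζ)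
    {p : ℝ × V3} (hp : p.2 ∈ Ω) (v : V6) :
    ⟪v, adjOp M (pairField η ζ) p⟫_ℝ
      = (-⟪matVec (M.ε p.2) v.fst, timeDeriv η p⟫_ℝ - ⟪v.snd, curl η p⟫_ℝ
          + ⟪matVec (M.σ p.2) v.fst, η p⟫_ℝ)
        + (-⟪matVec (M.μ p.2) v.snd, timeDeriv ζ p⟫_ℝ + ⟪v.fst, curl ζ p⟫_ℝ) := by
  rw [inner_adjOp M _ hp, spaceOp_pairField hη hζ, tDeriv_pairField hη hζ]
  change (⟪v.fst, curl ζ p⟫_ℝ + ⟪v.snd, -curl η p⟫_ℝ)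
    - (⟪matVec (M.ε p.2) v.fst, timeDeriv η p⟫_ℝ + ⟪matVec (M.μ p.2) v.snd, timeDeriv ζ p⟫_ℝ)
    + (⟪matVec (M.σ p.2) v.fst, η p⟫_ℝ + ⟪matVec 0 v.snd, ζ p⟫_ℝ) = _
  rw [inner_neg_right, zero_matVec, inner_zero_left]
  ring

end pairField

theorem timeDeriv_zero (p : ℝ × V3) : timeDeriv 0 p = 0 := by simp [timeDeriv]

theorem curl_zero (p : ℝ × V3) : curl 0 p = 0 := by simp [curl_eq_sum]

/-- A six-component test field is a pair `(η, ζ)`, and both sides are additive in it; the two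
equations are the cases `ζ = 0` and `η = 0`. The integrands are compared almost everywhere on the
cylinder, since the coefficients are symmetric on `Ω` only. -/
theorem isMaxwellSolution_iff (hΩ : MeasurableSet Ω) (M : Medium Ω) (q u : FieldSpace Ω a b) :
    IsMaxwellSolution M q u ↔ ∀ w, IsTest (Iio b) w →
      ∫ p, ⟪u p, adjOp M w p⟫_ℝ ∂(cylMeasure Ω a b) = ∫ p, ⟪q p, w p⟫_ℝ ∂(cylMeasure Ω a b) := by
  have hcyl := ae_mem_cyl (a := a) (b := b) hΩ
  have e1 : ∀ η, IsTestField b η → ∀ᵐ p ∂(cylMeasure Ω a b),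
      ⟪u p, adjOp M (pairField η 0) p⟫_ℝ
        = -⟪matVec (M.ε p.2) (u p).fst, timeDeriv η p⟫_ℝ - ⟪(u p).snd, curl η p⟫_ℝ
          + ⟪matVec (M.σ p.2) (u p).fst, η p⟫_ℝ := by
    intro η hη
    filter_upwards [hcyl] with p hp
    rw [inner_adjOp_pairField M hη.1 (isTestField_zero (b := b)).1 hp.2, timeDeriv_zero, curl_zero]
    simp
  have e2 : ∀ ζ, IsTestField b ζ → ∀ᵐ p ∂(cylMeasure Ω a b),
      ⟪u p, adjOp M (pairField 0 ζ) p⟫_ℝ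
        = -⟪matVec (M.μ p.2) (u p).snd, timeDeriv ζ p⟫_ℝ + ⟪(u p).fst, curl ζ p⟫_ℝ := by
    intro ζ hζ
    filter_upwards [hcyl] with p hp
    rw [inner_adjOp_pairField M (isTestField_zero (b := b)).1 hζ.1 hp.2, timeDeriv_zero, curl_zero]
    simp
  have r1 : ∀ (η : ℝ × V3 → V3) p, ⟪q p, pairField η 0 p⟫_ℝ = ⟪(q p).fst, η p⟫_ℝ := by
    intro η p
    change ⟪(q p).fst, η p⟫_ℝ + ⟪(q p).snd, 0⟫_ℝ = _
    rw [inner_zero_right, add_zero]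
  have r2 : ∀ (ζ : ℝ × V3 → V3) p, ⟪q p, pairField 0 ζ p⟫_ℝ = ⟪(q p).snd, ζ p⟫_ℝ := by
    intro ζ p
    change ⟪(q p).fst, 0⟫_ℝ + ⟪(q p).snd, ζ p⟫_ℝ = _
    rw [inner_zero_right, zero_add]
  constructor
  · rintro ⟨h1, h2⟩ w hw
    set η : ℝ × V3 → V3 := fun p => WithLp.fstL 2 ℝ V3 V3 (w p)
    set ζ : ℝ × V3 → V3 := fun p => WithLp.sndL 2 ℝ V3 V3 (w p)
    have hη : IsTestField b η := hw.isTestField _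
    have hζ : IsTestField b ζ := hw.isTestField _
    have hw' : w = pairField η ζ := rfl
    have h1' := h1 η hη
    have h2' := h2 ζ hζ
    rw [← integral_congr_ae (e1 η hη), ← integral_congr_ae (Eventually.of_forall (r1 η))] at h1'
    rw [← integral_congr_ae (e2 ζ hζ), ← integral_congr_ae (Eventually.of_forall (r2 ζ))] at h2'
    have t1 := isTest_pairField hη (isTestField_zero (b := b))
    have t2 := isTest_pairField (isTestField_zero (b := b)) hζ
    have hu := Lp.memLp u
    have hq := Lp.memLp q
    have s1 := integral_add (hu.integrable_inner_two (memLp_adjOp hΩ M t1))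
      (hu.integrable_inner_two (memLp_adjOp hΩ M t2))
    have s2 := integral_add (hq.integrable_inner_two (t1.memLp.restrict _))
      (hq.integrable_inner_two (t2.memLp.restrict _))
    refine Eq.trans (integral_congr_ae ?_)
      (s1.trans ((congrArg₂ (· + ·) h1' h2').trans (s2.symm.trans (integral_congr_ae ?_))))
    · filter_upwards [hcyl, e1 η hη, e2 ζ hζ] with p hp a1 a2
      rw [a1, a2, hw', inner_adjOp_pairField M hη.1 hζ.1 hp.2]
    · refine Eventually.of_forall fun p => ?_
      simp only [r1, r2]
      rfl
  · intro h
    refine ⟨fun η hη => ?_, fun ζ hζ => ?_⟩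
    · rw [← integral_congr_ae (e1 η hη), ← integral_congr_ae (Eventually.of_forall (r1 η))]
      exact h _ (isTest_pairField hη isTestField_zero)
    · rw [← integral_congr_ae (e2 ζ hζ), ← integral_congr_ae (Eventually.of_forall (r2 ζ))]
      exact h _ (isTest_pairField isTestField_zero hζ)

/-! ### Extension by zero -/

/-- The extension of a field by zero to the whole of space-time. -/
def zeroExt (u : FieldSpace Ω a b) : ℝ × V3 → V6 := (Icc a b ×ˢ Ω).indicator u

theorem zeroExt_of_mem (u : FieldSpace Ω a b) {p : ℝ × V3} (hp : p ∈ Icc a b ×ˢ Ω) :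
    zeroExt u p = u p := indicator_of_mem hp _

theorem zeroExt_of_notMem (u : FieldSpace Ω a b) {p : ℝ × V3} (hp : p ∉ Icc a b ×ˢ Ω) :
    zeroExt u p = 0 := indicator_of_notMem hp _

theorem mem_of_zeroExt_ne_zero {u : FieldSpace Ω a b} {p : ℝ × V3} (hp : zeroExt u p ≠ 0) :
    p ∈ Icc a b ×ˢ Ω := by
  by_contra h
  exact hp (zeroExt_of_notMem u h)

theorem memLp_zeroExt (hΩ : IsOpen Ω) (u : FieldSpace Ω a b) : MemLp (zeroExt u) 2 :=
  (memLp_indicator_iff_restrict (measurableSet_Icc.prod hΩ.measurableSet)).mpr (Lp.memLp u)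

/-- Bounds on the coefficients are available on `Ω` only; off the cylinder the product vanishes with
the field. -/
theorem memLp_blockFun_zeroExt (hΩ : IsOpen Ω) {A B : V3 → Matrix (Fin 3) (Fin 3) ℝ}
    (hA : IsBddMeas Ω A) (hB : IsBddMeas Ω B) (u : FieldSpace Ω a b) :
    MemLp (blockFun A B (zeroExt u)) 2 := by
  have h := (memLp_indicator_iff_restrict (measurableSet_Icc.prod hΩ.measurableSet)).mpr
    (memLp_blockFun hΩ.measurableSet hA hB u)
  refine h.ae_eq (Eventually.of_forall fun p => ?_)
  by_cases hp : p ∈ Icc a b ×ˢ Ω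
  · rw [indicator_of_mem hp, blockFun_apply, blockFun_apply, zeroExt_of_mem u hp]
  · rw [indicator_of_notMem hp, blockFun_apply, zeroExt_of_notMem u hp, blockVec_zero]

theorem integral_inner_zeroExt (hΩ : IsOpen Ω) (u : FieldSpace Ω a b) (f : ℝ × V3 → V6) :
    ∫ p, ⟪zeroExt u p, f p⟫_ℝ = ∫ p, ⟪u p, f p⟫_ℝ ∂(cylMeasure Ω a b) := by
  change _ = ∫ p in Icc a b ×ˢ Ω, ⟪u p, f p⟫_ℝ
  rw [← integral_indicator (measurableSet_Icc.prod hΩ.measurableSet)]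
  refine integral_congr_ae (Eventually.of_forall fun p => ?_)
  by_cases hp : p ∈ Icc a b ×ˢ Ω
  · simp only [indicator_of_mem hp, zeroExt_of_mem u hp]
  · simp only [indicator_of_notMem hp, zeroExt_of_notMem u hp, inner_zero_left]

/-- Test fields are unrestricted at time `a` and on `∂Ω`, so the zero extension satisfies the system
across both. This is how the initial and boundary conditions are used. The conductivity term is
counted as part of the source. -/
theorem IsMaxwellSolution.weakSystem (hΩ : IsOpen Ω) {M : Medium Ω} {q u : FieldSpace Ω a b}
    (h : IsMaxwellSolution M q u) :
    WeakSystem (Iio b) (blockFun M.ε M.μ (zeroExt u)) (zeroExt u)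
      (fun p => zeroExt q p - blockFun M.σ (fun _ => 0) (zeroExt u) p) := by
  intro w hw
  have key := (isMaxwellSolution_iff hΩ.measurableSet M q u).mp h w hw
  rw [← integral_inner_zeroExt hΩ, ← integral_inner_zeroExt hΩ] at key
  have iA := ((memLp_zeroExt hΩ u).integrable_inner_two hw.memLp_spaceOp).sub
    ((memLp_blockFun_zeroExt hΩ M.ε_bdd M.μ_bdd u).integrable_inner_two hw.memLp_tDeriv)
  have iB := (memLp_blockFun_zeroExt hΩ M.σ_bdd isBddMeas_zero u).integrable_inner_two hw.memLp
  have iQ := (memLp_zeroExt hΩ q).integrable_inner_two hw.memLp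
  have e1 := integral_add iA iB
  have e2 := integral_sub iQ iB
  have e3 : ∫ p, ⟪zeroExt u p, adjOp M w p⟫_ℝ = _ := Eq.trans
    (integral_congr_ae (Eventually.of_forall fun p => ?_)) e1
  · simp only [inner_sub_left, Pi.sub_apply] at e2 e3 ⊢
    linarith
  · by_cases hp : p ∈ Icc a b ×ˢ Ω
    · exact inner_adjOp M w hp.2 _
    · simp only [Pi.sub_apply, blockFun_apply, zeroExt_of_notMem u hp, blockVec_zero,
        inner_zero_left, sub_zero, add_zero]

theorem inner_blockFun_zeroExt {A B : V3 → Matrix (Fin 3) (Fin 3) ℝ}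
    (sA : ∀ x ∈ Ω, (A x).IsSymm) (sB : ∀ x ∈ Ω, (B x).IsSymm) (u : FieldSpace Ω a b)
    (p : ℝ × V3) (v : V6) (hv : p.2 ∉ Ω → v = 0) :
    ⟪blockFun A B (zeroExt u) p, v⟫_ℝ = ⟪zeroExt u p, blockVec (A p.2) (B p.2) v⟫_ℝ := by
  by_cases hp : p.2 ∈ Ω
  · exact inner_blockVec (sA _ hp) (sB _ hp) _ _
  · rw [hv hp, blockVec_zero, inner_zero_right, inner_zero_right]

/-! ### Reversal of extended fields and the adjoint identity -/

theorem blockFun_reverseFun (A B : V3 → Matrix (Fin 3) (Fin 3) ℝ) (T : ℝ) (f : ℝ × V3 → V6)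
    (p : ℝ × V3) : blockFun A B (reverseFun T f) p = reverseFun T (blockFun A B f) p :=
  blockVec_flipE _ _ _

theorem MeasureTheory.MemLp.reverse {T : ℝ} {f : ℝ × V3 → V6} (hf : MemLp f 2) :
    MemLp (reverseFun T f) 2 :=
  flipE.comp_memLp' (hf.comp_measurePreserving (measurePreserving_reflectTime T))

theorem coeFn_timeReversal (hΩ : IsOpen Ω) (T : ℝ) {a' b' : ℝ} (h : a + b' = 2 * T)
    (h' : b + a' = 2 * T) (q : FieldSpace Ω a b) :
    timeReversal hΩ T h h' q =ᵐ[cylMeasure Ω a' b'] reverseFun T q :=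
  MemLp.coeFn_toLp _

theorem integral_inner_reverse_zeroExt (hΩ : IsOpen Ω) (T : ℝ) {a' b' : ℝ} (h : a' + b = 2 * T)
    (h' : b' + a = 2 * T) (u : FieldSpace Ω a b) (q : FieldSpace Ω a' b') :
    ∫ p, ⟪zeroExt u p, reverseFun T (zeroExt q) p⟫_ℝ = ⟪u, timeReversal hΩ T h h' q⟫_ℝ := by
  rw [integral_inner_zeroExt hΩ, inner_eq_integral]
  refine integral_congr_ae ?_
  filter_upwards [coeFn_timeReversal hΩ T h h' q, ae_mem_cyl hΩ.measurableSet] with p h1 h2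
  have h3 : reflectTime T p ∈ Icc a' b' ×ˢ Ω :=
    ⟨⟨by simp only [reflectTime_apply]; linarith [h2.1.2],
      by simp only [reflectTime_apply]; linarith [h2.1.1]⟩, h2.2⟩
  rw [h1, reverseFun_apply, reverseFun_apply, zeroExt_of_mem q h3]

/-- Green's formula for a solution over `[a, b]` and a solution over the reflected interval. -/
theorem inner_timeReversal (hΩ : IsOpen Ω) {M : Medium Ω} (T : ℝ) {a' b' : ℝ}
    (h : a' + b = 2 * T) (h' : b' + a = 2 * T) {q u : FieldSpace Ω a b}
    {p w : FieldSpace Ω a' b'} (Hu : IsMaxwellSolution M q u) (Hw : IsMaxwellSolution M p w) :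
    ⟪q, timeReversal hΩ T h h' w⟫_ℝ = ⟪u, timeReversal hΩ T h h' p⟫_ℝ := by
  have Ww := (Hw.weakSystem hΩ).reverse (T := T) (J := Ioi a) fun t ht => by
    simp only [mem_Ioi, mem_Iio] at ht ⊢
    linarith
  set W := reverseFun T (zeroExt w) with hW
  have hW0 : ∀ p, W p ≠ 0 → p.1 ∈ Icc a b ∧ p.2 ∈ Ω := by
    intro p hp
    have h1 : zeroExt w (reflectTime T p) ≠ 0 := by
      intro h0
      exact hp (by rw [hW, reverseFun_apply, h0, map_zero])
    have h2 := mem_of_zeroExt_ne_zero h1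
    rw [reflectTime_apply] at h2
    exact ⟨⟨by linarith [h2.1.2], by linarith [h2.1.1]⟩, h2.2⟩
  have mr : MemLp (fun x => zeroExt q x - blockFun M.σ (fun _ => 0) (zeroExt u) x) 2 :=
    (memLp_zeroExt hΩ q).sub (memLp_blockFun_zeroExt hΩ M.σ_bdd isBddMeas_zero u)
  have ml : MemLp (fun x => -reverseFun T (fun y => zeroExt p y
      - blockFun M.σ (fun _ => 0) (zeroExt w) y) x) 2 := ((memLp_zeroExt hΩ p).sub
    (memLp_blockFun_zeroExt hΩ M.σ_bdd isBddMeas_zero w)).reverse (T := T) |>.neg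
  have mW : MemLp W 2 := (memLp_zeroExt hΩ w).reverse
  -- The compatibility condition holds because a shift in time does not change `x`: the symmetric
  -- matrix `Γ(x)` is the same at both points.
  have key := pairing (Hu.weakSystem hΩ) Ww (memLp_blockFun_zeroExt hΩ M.ε_bdd M.μ_bdd u)
    (memLp_zeroExt hΩ u) mr (memLp_blockFun_zeroExt hΩ M.ε_bdd M.μ_bdd w).reverse mW ml
    (fun p hp => (mem_of_zeroExt_ne_zero hp).1) (fun p hp => (hW0 p hp).1) fun p s => by
      rw [← blockFun_reverseFun, inner_blockFun_zeroExt M.ε_pos.1 M.μ_pos.1]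
      · simp only [blockFun_apply, Prod.snd_sub, sub_zero]
        rfl
      · intro hp
        by_contra hne
        have := (hW0 _ hne).2
        simp only [Prod.snd_sub, sub_zero] at this
        exact hp this
  rw [← integral_add (mr.integrable_inner_two mW)
    ((memLp_zeroExt hΩ u).integrable_inner_two ml)] at key
  have mp : MemLp (reverseFun T (zeroExt p)) 2 := (memLp_zeroExt hΩ p).reverse
  rw [← integral_inner_reverse_zeroExt hΩ T h h', ← integral_inner_reverse_zeroExt hΩ T h h',
    ← sub_eq_zero, ← integral_sub ((memLp_zeroExt hΩ q).integrable_inner_two mW)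
      ((memLp_zeroExt hΩ u).integrable_inner_two mp), ← key]
  refine integral_congr_ae (Eventually.of_forall fun x => ?_)
  have e1 : reverseFun T (fun p_1 => zeroExt p p_1 - blockFun M.σ (fun _ => 0) (zeroExt w) p_1) x
      = reverseFun T (zeroExt p) x - blockFun M.σ (fun _ => 0) W x := by
    rw [hW, blockFun_reverseFun]
    simp only [reverseFun_apply, map_sub]
  -- The two sources are `q - σ u` and `-(𝒮_e p - σ W)`. Their conductivity terms enter with
  -- opposite signs and cancel by the symmetry of `σ`.
  have e2 : ⟪blockFun M.σ (fun _ => 0) (zeroExt u) x, W x⟫_ℝ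
      = ⟪zeroExt u x, blockFun M.σ (fun _ => 0) W x⟫_ℝ :=
    inner_blockFun_zeroExt (fun _ hx => M.σ_symm hx) (fun _ _ => isSymm_zero) u x (W x) fun hx => by
      by_contra hne
      exact hx (hW0 _ hne).2
  simp only [e1, inner_sub_left, inner_neg_right, inner_sub_right, e2]
  ring

theorem timeReversal_timeReversal (hΩ : IsOpen Ω) (T : ℝ) {a' b' : ℝ} (h : a + b' = 2 * T)
    (h' : b + a' = 2 * T) (k : a' + b = 2 * T) (k' : b' + a = 2 * T) (q : FieldSpace Ω a b) :
    timeReversal hΩ T k k' (timeReversal hΩ T h h' q) = q := by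
  refine Lp.ext ?_
  filter_upwards [coeFn_timeReversal hΩ T k k' (timeReversal hΩ T h h' q),
    (measurePreserving_reverse hΩ.measurableSet k k').quasiMeasurePreserving.ae
      (coeFn_timeReversal hΩ T h h' q)] with p h1 h2
  rw [h1, reverseFun_apply, reflectTime_apply, h2, reverseFun_apply, flipE_flipE,
    ← reflectTime_apply, reflectTime_reflectTime]

theorem isMaxwellSolution_sourceToField {M : Medium Ω} {q : FieldSpace Ω a b}
    (hq : q ∈ sourceDomain M a b) : IsMaxwellSolution M q (sourceToField M q) := by
  have hq' : ∃ u, IsMaxwellSolution M q u := hq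
  rw [sourceToField, dif_pos hq']
  exact hq'.choose_spec

/-- Apply `inner_timeReversal` with the source `𝒮_e Γ v`. Reversing it once more gives back `Γ v`,
and `⟨F q, Γ v⟩` is the energy product. -/
theorem isAdjointValue_reversalExperiment (hΩ : IsOpen Ω) (M : Medium Ω) (T : ℝ)
    (v : FieldSpace Ω 0 T) (hv : emReversal hΩ T (M.gamma hΩ v) ∈ sourceDomain M T (2 * T)) :
    IsAdjointValue M v (reversalExperiment hΩ M T v) := by
  intro q hq
  have h := inner_timeReversal hΩ T (by ring) (by ring) (isMaxwellSolution_sourceToField hq)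
    (isMaxwellSolution_sourceToField hv)
  rw [M.energyInner_eq hΩ, M.energyInner_eq hΩ, reversalExperiment, M.gamma_gammaInv]
  refine Eq.trans ?_ h.symm
  rw [emReversal, timeReversal_timeReversal]

/-- A dense set of sources determines `Γ z`, and `Γ` is injective. -/
theorem eq_of_isAdjointValue (hΩ : IsOpen Ω) {M : Medium Ω} (hd : Dense (sourceDomain M a b))
    {v z z' : FieldSpace Ω a b} (hz : IsAdjointValue M v z) (hz' : IsAdjointValue M v z') :
    z = z' := by
  have h : M.gamma hΩ z = M.gamma hΩ z' := by
    refine hd.eq_of_inner_right (𝕜 := ℝ) fun q hq => ?_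
    rw [← M.energyInner_eq hΩ, ← M.energyInner_eq hΩ, ← hz q hq, ← hz' q hq]
  rw [← M.gammaInv_gamma hΩ z, h, M.gammaInv_gamma]

/-! ### Maxwell's equations in terms of the inner product -/

/-- A test field as an element of the space of fields over `[a, b]`. -/
def IsTest.vec {I : Set ℝ} {w : ℝ × V3 → V6} (hw : IsTest I w) : FieldSpace Ω a b :=
  (hw.memLp.restrict (Icc a b ×ˢ Ω)).toLp w

/-- The adjoint Maxwell operator applied to a test field. -/
def IsTest.adjVec (hΩ : IsOpen Ω) (M : Medium Ω) {I : Set ℝ} {w : ℝ × V3 → V6}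
    (hw : IsTest I w) : FieldSpace Ω a b :=
  (memLp_adjOp hΩ.measurableSet M hw).toLp (adjOp M w)

/-- In this form the conditions are linear and continuous in `(q, u)`. Superposition, the closed
graph and the duality argument for existence are read off from it. -/
theorem isMaxwellSolution_iff_inner (hΩ : IsOpen Ω) (M : Medium Ω) (q u : FieldSpace Ω a b) :
    IsMaxwellSolution M q u ↔ ∀ w, ∀ hw : IsTest (Iio b) w,
      ⟪u, (hw.adjVec hΩ M : FieldSpace Ω a b)⟫_ℝ = ⟪q, (hw.vec : FieldSpace Ω a b)⟫_ℝ := by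
  rw [isMaxwellSolution_iff hΩ.measurableSet]
  refine forall₂_congr fun w hw => ?_
  have h1 : ∫ p, ⟪u p, adjOp M w p⟫_ℝ ∂(cylMeasure Ω a b)
      = ⟪u, (hw.adjVec hΩ M : FieldSpace Ω a b)⟫_ℝ := by
    rw [inner_eq_integral]
    refine integral_congr_ae ?_
    filter_upwards [(memLp_adjOp (a := a) (b := b) hΩ.measurableSet M hw).coeFn_toLp] with p hp
    exact congrArg (fun v => ⟪u p, v⟫_ℝ) hp.symm
  have h2 : ∫ p, ⟪q p, w p⟫_ℝ ∂(cylMeasure Ω a b) = ⟪q, (hw.vec : FieldSpace Ω a b)⟫_ℝ := by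
    rw [inner_eq_integral]
    refine integral_congr_ae ?_
    filter_upwards [(hw.memLp.restrict (Icc a b ×ˢ Ω)).coeFn_toLp] with p hp
    exact congrArg (fun v => ⟪q p, v⟫_ℝ) hp.symm
  rw [h1, h2]

theorem IsMaxwellSolution.add (hΩ : IsOpen Ω) {M : Medium Ω} {q u q' u' : FieldSpace Ω a b}
    (h : IsMaxwellSolution M q u) (h' : IsMaxwellSolution M q' u') :
    IsMaxwellSolution M (q + q') (u + u') := by
  rw [isMaxwellSolution_iff_inner hΩ] at *
  intro w hw
  rw [inner_add_left, inner_add_left, h w hw, h' w hw]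

theorem IsMaxwellSolution.smul (hΩ : IsOpen Ω) {M : Medium Ω} {q u : FieldSpace Ω a b}
    (h : IsMaxwellSolution M q u) (c : ℝ) : IsMaxwellSolution M (c • q) (c • u) := by
  rw [isMaxwellSolution_iff_inner hΩ] at *
  intro w hw
  rw [inner_smul_left, inner_smul_left, h w hw]

theorem IsMaxwellSolution.sub (hΩ : IsOpen Ω) {M : Medium Ω} {q u q' u' : FieldSpace Ω a b}
    (h : IsMaxwellSolution M q u) (h' : IsMaxwellSolution M q' u') :
    IsMaxwellSolution M (q - q') (u - u') := by
  rw [isMaxwellSolution_iff_inner hΩ] at *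
  intro w hw
  rw [inner_sub_left, inner_sub_left, h w hw, h' w hw]

theorem isClosed_isMaxwellSolution (hΩ : IsOpen Ω) (M : Medium Ω) :
    IsClosed {x : FieldSpace Ω a b × FieldSpace Ω a b | IsMaxwellSolution M x.1 x.2} := by
  simp only [isMaxwellSolution_iff_inner hΩ, ofPred_forall]
  refine isClosed_iInter fun w => isClosed_iInter fun hw => ?_
  exact isClosed_eq (continuous_snd.inner continuous_const) (continuous_fst.inner continuous_const)

/-! ### Positivity of the coefficients -/

theorem Medium.inner_σ_nonneg (M : Medium Ω) {x : V3} (hx : x ∈ Ω) (v : V6) :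
    0 ≤ ⟪blockVec (M.σ x) 0 v, v⟫_ℝ := by
  change 0 ≤ ⟪matVec (M.σ x) v.fst, v.fst⟫_ℝ + ⟪matVec 0 v.snd, v.snd⟫_ℝ
  rw [zero_matVec, inner_zero_left, add_zero, real_inner_comm, matVec,
    EuclideanSpace.inner_eq_star_dotProduct, dotProduct_comm]
  simpa using (M.σ_nonneg x hx).dotProduct_mulVec_nonneg v.fst.ofLp

theorem Medium.exists_coercive (M : Medium Ω) : ∃ c : ℝ, 0 < c ∧ ∀ x ∈ Ω, ∀ v : V6,
    c * ‖v‖ ^ 2 ≤ ⟪blockVec (M.ε x) (M.μ x) v, v⟫_ℝ := by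
  obtain ⟨-, c, hc, h⟩ := M.ε_pos
  obtain ⟨-, d, hd, k⟩ := M.μ_pos
  refine ⟨min c d, lt_min hc hd, fun x hx v => ?_⟩
  rw [WithLp.prod_norm_sq_eq_of_L2, mul_add]
  refine add_le_add (le_trans ?_ (h x hx v.fst)) (le_trans ?_ (k x hx v.snd))
  · exact mul_le_mul_of_nonneg_right (min_le_left _ _) (sq_nonneg _)
  · exact mul_le_mul_of_nonneg_right (min_le_right _ _) (sq_nonneg _)

/-! ### Uniqueness -/

theorem memLp_smul_time {ψ : ℝ → ℝ} (hψ : Continuous ψ) {f : ℝ × V3 → V6} (hf : MemLp f 2)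
    (h0 : ∀ p, f p ≠ 0 → p.1 ∈ Icc a b) : MemLp (fun p => ψ p.1 • f p) 2 := by
  obtain ⟨C, hC⟩ := isCompact_Icc.exists_bound_of_continuousOn (hψ.continuousOn (s := Icc a b))
  refine hf.of_le_mul (c := C)
    ((hψ.comp continuous_fst).aestronglyMeasurable.smul hf.1) (Eventually.of_forall fun p => ?_)
  by_cases hp : f p = 0
  · simp [hp]
  · rw [norm_smul]
    exact mul_le_mul_of_nonneg_right (hC _ (h0 p hp)) (norm_nonneg _)

/-- A smooth function of time that is positive and decreasing before `c` and vanishes after. -/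
def timeWeight (c t : ℝ) : ℝ := expNegInvGlue (c - t)

/-- The derivative of `timeWeight`. -/
def timeWeightDeriv (c t : ℝ) : ℝ := -(((c - t)⁻¹) ^ 2 * expNegInvGlue (c - t))

theorem contDiff_timeWeight (c : ℝ) : ContDiff ℝ ∞ (timeWeight c) :=
  (expNegInvGlue.contDiff (n := ⊤)).comp (contDiff_const.sub contDiff_id)

theorem hasDerivAt_timeWeight (c t : ℝ) : HasDerivAt (timeWeight c) (timeWeightDeriv c t) t := by
  -- The case `P = 1` of the formula for the derivative of `P(1/x) exp(-1/x)`; it is valid for `x ≤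
  -- 0` too.
  have h := expNegInvGlue.hasDerivAt_polynomial_eval_inv_mul 1 (c - t)
  simp only [Polynomial.eval_one, one_mul, Polynomial.derivative_one, sub_zero, mul_one,
    Polynomial.eval_pow, Polynomial.eval_X] at h
  have h2 := h.comp t ((hasDerivAt_id t).const_sub c)
  rw [mul_neg_one] at h2
  exact h2

theorem continuous_timeWeightDeriv (c : ℝ) : Continuous (timeWeightDeriv c) := by
  have : timeWeightDeriv c = deriv (timeWeight c) :=
    funext fun t => (hasDerivAt_timeWeight c t).deriv.symm
  rw [this]
  exact (contDiff_timeWeight c).continuous_deriv (by simp)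

theorem timeWeight_nonneg (c t : ℝ) : 0 ≤ timeWeight c t := expNegInvGlue.nonneg _

theorem timeWeightDeriv_nonpos (c t : ℝ) : timeWeightDeriv c t ≤ 0 :=
  neg_nonpos.mpr (mul_nonneg (sq_nonneg _) (expNegInvGlue.nonneg _))

theorem timeWeightDeriv_neg {c t : ℝ} (h : t < c) : timeWeightDeriv c t < 0 := by
  have h1 : 0 < c - t := sub_pos.mpr h
  exact neg_neg_of_pos (mul_pos (pow_pos (inv_pos.mpr h1) 2) (expNegInvGlue.pos_of_pos h1))

theorem fderiv_timeWeight (c : ℝ) (p v : ℝ × V3) :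
    fderiv ℝ (fun p : ℝ × V3 => timeWeight c p.1) p v = timeWeightDeriv c p.1 * v.1 := by
  have h : HasFDerivAt (fun p : ℝ × V3 => timeWeight c p.1) _ p :=
    (hasDerivAt_timeWeight c p.1).hasFDerivAt.comp p hasFDerivAt_fst
  rw [h.fderiv]
  simp [mul_comm]

theorem tsupport_timeWeight (c : ℝ) {p : ℝ × V3}
    (hp : p ∈ tsupport fun p : ℝ × V3 => timeWeight c p.1) : p.1 ≤ c := by
  refine closure_minimal (s := Function.support fun p : ℝ × V3 => timeWeight c p.1)
    (t := {p | p.1 ≤ c}) (fun x hx => ?_) (isClosed_le continuous_fst continuous_const) hp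
  by_contra hcon
  exact hx (expNegInvGlue.zero_of_nonpos (by simp only [mem_ofPred_eq, not_le] at hcon; linarith))

theorem zeroExt_zero_ae (hΩ : IsOpen Ω) :
    ∀ᵐ p : ℝ × V3, zeroExt (0 : FieldSpace Ω a b) p = 0 := by
  have h : ∀ᵐ p ∂((volume : Measure (ℝ × V3)).restrict (Icc a b ×ˢ Ω)),
    (0 : FieldSpace Ω a b) p = 0 := Lp.coeFn_zero V6 2 (cylMeasure Ω a b)
  rw [ae_restrict_iff' (measurableSet_Icc.prod hΩ.measurableSet)] at h
  filter_upwards [h] with p hp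
  by_cases hps : p ∈ Icc a b ×ˢ Ω
  · rw [zeroExt_of_mem _ hps, hp hps]
  · exact zeroExt_of_notMem _ hps

theorem eq_zero_of_zeroExt_ae (hΩ : IsOpen Ω) {u : FieldSpace Ω a b}
    (h : ∀ᵐ p : ℝ × V3, zeroExt u p = 0) : u = 0 := by
  refine Lp.ext ?_
  have h' : ∀ᵐ p ∂(cylMeasure Ω a b), zeroExt u p = 0 := ae_restrict_of_ae h
  filter_upwards [Lp.coeFn_zero V6 2 (cylMeasure Ω a b), h', ae_mem_cyl hΩ.measurableSet]
    with p h1 h2 h3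
  rw [h1, ← zeroExt_of_mem u h3, h2]
  rfl

/-- Energy method: pair `u` with `ψ u`, where `ψ` is `timeWeight c`. The source of `ψ u` is `-ψ σ u
+ ψ' Γ u`, and Green's formula becomes `∫ (2 ψ σu · u - ψ' Γu · u) = 0`. Both terms are nonnegative,
so `u` vanishes wherever `ψ' < 0`. -/
theorem IsMaxwellSolution.zeroExt_eq_zero_of_lt (hΩ : IsOpen Ω) {M : Medium Ω}
    {u : FieldSpace Ω a b} (h : IsMaxwellSolution M 0 u) {c : ℝ} (hc : c < b) :
    ∀ᵐ p : ℝ × V3, p.1 < c → zeroExt u p = 0 := by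
  have Hu := h.weakSystem hΩ
  set g := blockFun M.ε M.μ (zeroExt u) with hg
  set s := blockFun M.σ (fun _ => 0) (zeroExt u) with hs
  have mu := memLp_zeroExt hΩ u
  have mg : MemLp g 2 := memLp_blockFun_zeroExt hΩ M.ε_bdd M.μ_bdd u
  have mr : MemLp (fun p => zeroExt (0 : FieldSpace Ω a b) p - s p) 2 :=
    (memLp_zeroExt hΩ 0).sub (memLp_blockFun_zeroExt hΩ M.σ_bdd isBddMeas_zero u)
  have su : ∀ p, zeroExt u p ≠ 0 → p.1 ∈ Icc a b := fun p hp => (mem_of_zeroExt_ne_zero hp).1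
  have sg : ∀ p, g p ≠ 0 → p.1 ∈ Icc a b := fun p hp => su p fun h0 =>
    hp (by rw [hg, blockFun_apply, h0, blockVec_zero])
  have sr : ∀ p, zeroExt (0 : FieldSpace Ω a b) p - s p ≠ 0 → p.1 ∈ Icc a b := by
    intro p hp
    by_contra hcon
    have hps : p ∉ Icc a b ×ˢ Ω := fun hps => hcon hps.1
    exact hp (by rw [hs, blockFun_apply, zeroExt_of_notMem _ hps, zeroExt_of_notMem _ hps,
      blockVec_zero, sub_zero])
  have hχ : ContDiff ℝ ∞ fun p : ℝ × V3 => timeWeight c p.1 :=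
    (contDiff_timeWeight c).comp contDiff_fst
  -- The weight is zero after `c < b`, so test fields for the product no longer have to vanish near
  -- `b`. This makes it a legitimate backward solution in `pairing`.
  have Hw := Hu.smul (J := Ioi a) mg mu mr hχ fun p hp _ =>
    (tsupport_timeWeight c hp).trans_lt hc
  have hgrad : ∀ p v, gradSymbol (fun p : ℝ × V3 => timeWeight c p.1) p v = 0 := fun p v => by
    simp [gradSymbol, fderiv_timeWeight]
  simp only [hgrad, fderiv_timeWeight, mul_one, sub_zero] at Hw
  have hcont := (contDiff_timeWeight c).continuous
  have ml := (memLp_smul_time hcont mr sr).add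
    (memLp_smul_time (continuous_timeWeightDeriv c) mg sg)
  have mw := memLp_smul_time hcont mu su
  have key := pairing Hu Hw mg mu mr (memLp_smul_time hcont mg sg) mw ml su
    (fun p hp => su p (right_ne_zero_of_smul hp)) fun p t => by
      simp only [inner_smul_right]
      rw [hg, inner_blockFun_zeroExt M.ε_pos.1 M.μ_pos.1, blockFun_apply]
      · simp only [Prod.snd_sub, sub_zero]
      · intro hp
        refine zeroExt_of_notMem u fun hps => hp ?_
        simpa using hps.2
  have ir := mr.integrable_inner_two mw
  have il := mu.integrable_inner_two ml
  have key2 := (integral_add ir il).trans key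
  have hval : ∀ᵐ p : ℝ × V3, ⟪zeroExt (0 : FieldSpace Ω a b) p - s p,
      timeWeight c p.1 • zeroExt u p⟫_ℝ + ⟪zeroExt u p, timeWeight c p.1 •
        (zeroExt (0 : FieldSpace Ω a b) p - s p) + timeWeightDeriv c p.1 • g p⟫_ℝ
      = -(2 * timeWeight c p.1 * ⟪s p, zeroExt u p⟫_ℝ
        + -timeWeightDeriv c p.1 * ⟪g p, zeroExt u p⟫_ℝ) := by
    filter_upwards [zeroExt_zero_ae (a := a) (b := b) hΩ] with p hp
    rw [hp, zero_sub, inner_add_right, inner_smul_right, inner_smul_right, inner_smul_right,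
      inner_neg_left, inner_neg_right, real_inner_comm (s p), real_inner_comm (g p)]
    ring
  have hs0 : ∀ p, 0 ≤ ⟪s p, zeroExt u p⟫_ℝ := by
    intro p
    by_cases hp : p ∈ Icc a b ×ˢ Ω
    · exact M.inner_σ_nonneg hp.2 _
    · rw [zeroExt_of_notMem u hp, inner_zero_right]
  obtain ⟨d, hd, hcoer⟩ := M.exists_coercive
  have hg0 : ∀ p, d * ‖zeroExt u p‖ ^ 2 ≤ ⟪g p, zeroExt u p⟫_ℝ := by
    intro p
    by_cases hp : p ∈ Icc a b ×ˢ Ω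
    · exact hcoer _ hp.2 _
    · rw [zeroExt_of_notMem u hp, inner_zero_right]
      simp
  have hA : ∀ p : ℝ × V3, 0 ≤ 2 * timeWeight c p.1 * ⟪s p, zeroExt u p⟫_ℝ := fun p =>
    mul_nonneg (mul_nonneg zero_le_two (timeWeight_nonneg _ _)) (hs0 p)
  have hB : ∀ p : ℝ × V3, 0 ≤ -timeWeightDeriv c p.1 * ⟪g p, zeroExt u p⟫_ℝ := fun p =>
    mul_nonneg (neg_nonneg.mpr (timeWeightDeriv_nonpos _ _))
      (le_trans (by positivity) (hg0 p))
  have key3 := (integral_congr_ae hval).symm.trans key2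
  rw [integral_neg, neg_eq_zero, integral_eq_zero_iff_of_nonneg
    (fun p => add_nonneg (hA p) (hB p))] at key3
  · filter_upwards [key3] with p hp hpc
    have h1 : -timeWeightDeriv c p.1 * ⟪g p, zeroExt u p⟫_ℝ = 0 := by
      have hp' : 2 * timeWeight c p.1 * ⟪s p, zeroExt u p⟫_ℝ
        + -timeWeightDeriv c p.1 * ⟪g p, zeroExt u p⟫_ℝ = 0 := hp
      linarith [hA p, hB p]
    have h2 : ⟪g p, zeroExt u p⟫_ℝ = 0 :=
      (mul_eq_zero.mp h1).resolve_left (neg_ne_zero.mpr (timeWeightDeriv_neg hpc).ne)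
    have h3 := hg0 p
    rw [h2] at h3
    have h4 : ‖zeroExt u p‖ ^ 2 ≤ 0 := nonpos_of_mul_nonpos_right h3 hd
    exact norm_eq_zero.mp (pow_eq_zero_iff two_ne_zero |>.mp (le_antisymm h4 (sq_nonneg _)))
  · have h5 := (ir.add il).congr hval
    exact h5.neg.congr (Eventually.of_forall fun p => neg_neg _)

/-- The times `b - 1 / (n + 1)` exhaust `t < b`, and the slice `t = b` is null. -/
theorem IsMaxwellSolution.eq_zero (hΩ : IsOpen Ω) {M : Medium Ω} {u : FieldSpace Ω a b}
    (h : IsMaxwellSolution M 0 u) : u = 0 := by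
  refine eq_zero_of_zeroExt_ae hΩ ?_
  have h1 : ∀ᵐ p : ℝ × V3, ∀ n : ℕ, p.1 < b - 1 / ((n : ℝ) + 1) → zeroExt u p = 0 :=
    ae_all_iff.mpr fun n => h.zeroExt_eq_zero_of_lt hΩ
      (sub_lt_self b (by positivity))
  have h2 : ∀ᵐ p : ℝ × V3, p.1 ≠ b :=
    Measure.quasiMeasurePreserving_fst.ae (p := fun t : ℝ => t ≠ b)
      (Measure.ae_ne volume b)
  filter_upwards [h1, h2] with p hp hpb
  by_cases hps : p ∈ Icc a b ×ˢ Ω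
  · have hlt : p.1 < b := lt_of_le_of_ne hps.1.2 hpb
    obtain ⟨n, hn⟩ := exists_nat_one_div_lt (sub_pos.mpr hlt)
    exact hp n (by linarith)
  · exact zeroExt_of_notMem u hps

theorem IsMaxwellSolution.unique (hΩ : IsOpen Ω) {M : Medium Ω} {q u u' : FieldSpace Ω a b}
    (h : IsMaxwellSolution M q u) (h' : IsMaxwellSolution M q u') : u = u' := by
  have := h.sub hΩ h'
  rw [sub_self] at this
  exact sub_eq_zero.mp (this.eq_zero hΩ)

/-! ### Existence in the whole space -/

/-- The solvability of a weak equation from an a priori estimate for the adjoint problem. -/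
theorem exists_inner_eq_of_le {W H : Type*} [AddCommGroup W] [Module ℝ W]
    [NormedAddCommGroup H] [InnerProductSpace ℝ H] [CompleteSpace H] (f : W →ₗ[ℝ] H)
    (l : W →ₗ[ℝ] ℝ) (C : ℝ) (h : ∀ w, |l w| ≤ C * ‖f w‖) : ∃ u : H, ∀ w, ⟪u, f w⟫_ℝ = l w := by
  -- A linear choice of preimages makes `l ∘ s` a bounded functional on the range of `f`.
  -- Hahn–Banach extends it to `H`, and Riesz represents the extension.
  obtain ⟨s, hs⟩ := f.rangeRestrict.exists_rightInverse_of_surjective f.range_rangeRestrict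
  have hs' : ∀ y : f.range, f (s y) = y := fun y => congrArg Subtype.val (LinearMap.congr_fun hs y)
  let l' : f.range →L[ℝ] ℝ := (l ∘ₗ s).mkContinuous C fun y => by
    have := h (s y)
    rwa [hs'] at this
  obtain ⟨g, hg, -⟩ := exists_extension_norm_eq f.range l'
  refine ⟨(InnerProductSpace.toDual ℝ H).symm g, fun w => ?_⟩
  rw [InnerProductSpace.toDual_symm_apply]
  have h1 : g (f w) = l (s ⟨f w, w, rfl⟩) := hg ⟨f w, w, rfl⟩
  -- The difference lies in the kernel of `f`, where the bound forces `l = 0`; so the choice of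
  -- preimage does not matter.
  have h2 := h (w - s ⟨f w, w, rfl⟩)
  rw [map_sub f, hs', sub_self, norm_zero, mul_zero, map_sub] at h2
  rw [h1]
  exact (sub_eq_zero.mp (abs_eq_zero.mp (le_antisymm h2 (abs_nonneg _)))).symm

/-! ### The vector space of test fields -/

theorem hasCompactSupport_add_field {F : Type*} [NormedAddCommGroup F] {w w' : ℝ × V3 → F}
    (hw : HasCompactSupport w) (hw' : HasCompactSupport w') :
    HasCompactSupport (w + w') := hw.add hw'

theorem tsupport_add_field {F : Type*} [NormedAddCommGroup F] {w w' : ℝ × V3 → F} :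
    tsupport (w + w') ⊆ tsupport w ∪ tsupport w' :=
  tsupport_add w w'

section linear

variable {F : Type*} [NormedAddCommGroup F] [NormedSpace ℝ F] {w w' : ℝ × V3 → F}

theorem contDiff_add_field (hw : ContDiff ℝ ∞ w) (hw' : ContDiff ℝ ∞ w') :
    ContDiff ℝ ∞ (w + w') := hw.add hw'

theorem fderiv_add_field (hw : ContDiff ℝ ∞ w) (hw' : ContDiff ℝ ∞ w') (p v : ℝ × V3) :
    fderiv ℝ (w + w') p v = fderiv ℝ w p v + fderiv ℝ w' p v := by
  rw [fderiv_add (hw.differentiable (by simp) p) (hw'.differentiable (by simp) p)]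
  rfl

theorem contDiff_const_smul_field (hw : ContDiff ℝ ∞ w) (c : ℝ) : ContDiff ℝ ∞ (c • w) :=
  hw.const_smul c

theorem fderiv_constSMul_field (hw : ContDiff ℝ ∞ w) (c : ℝ) (p v : ℝ × V3) :
    fderiv ℝ (c • w) p v = c • fderiv ℝ w p v := by
  rw [fderiv_const_smul (hw.differentiable (by simp) p)]
  rfl

theorem hasCompactSupport_const_smul_field (hw : HasCompactSupport w) (c : ℝ) :
    HasCompactSupport (c • w) := hw.smul_left (f := fun _ => c)

theorem tsupport_const_smul_field (c : ℝ) : tsupport (c • w) ⊆ tsupport w :=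
  tsupport_smul_subset_right (fun _ => c) w

end linear

section testSpace

variable {I : Set ℝ} {w w' : ℝ × V3 → V6}

theorem IsTest.add (hw : IsTest I w) (hw' : IsTest I w') : IsTest I (w + w') :=
  ⟨contDiff_add_field hw.1 hw'.1, hasCompactSupport_add_field hw.2 hw'.2,
    fun p hp => (tsupport_add_field hp).elim (hw.3 p) (hw'.3 p)⟩

theorem IsTest.const_smul (hw : IsTest I w) (c : ℝ) : IsTest I (c • w) :=
  ⟨contDiff_const_smul_field hw.1 c, hasCompactSupport_const_smul_field hw.2 c,
    fun p hp => hw.3 p (tsupport_const_smul_field c hp)⟩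

/-- The space of test fields. -/
def testSpace (I : Set ℝ) : Submodule ℝ (ℝ × V3 → V6) where
  carrier := {w | IsTest I w}
  add_mem' h h' := IsTest.add h h'
  zero_mem' := ⟨contDiff_const, HasCompactSupport.zero, fun p hp => by simp [tsupport] at hp⟩
  smul_mem' c _ h := IsTest.const_smul h c

theorem adjOp_add (M : Medium Ω) (hw : IsTest I w) (hw' : IsTest I w') :
    adjOp M (w + w') = adjOp M w + adjOp M w' := by
  funext p
  simp only [adjOp, spaceOp, tDeriv, blockFun_apply, fderiv_add_field hw.1 hw'.1, map_add,
    Finset.sum_add_distrib, blockVec_add, Pi.add_apply]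
  abel

theorem adjOp_const_smul (M : Medium Ω) (hw : IsTest I w) (c : ℝ) :
    adjOp M (c • w) = c • adjOp M w := by
  funext p
  simp only [adjOp, spaceOp, tDeriv, blockFun_apply, fderiv_constSMul_field hw.1, map_smul,
    ← Finset.smul_sum, blockVec_smul, Pi.smul_apply, smul_add, smul_sub]

/-- The inclusion of the test fields into the fields over `[a, b]`. -/
def testVecL (I : Set ℝ) : testSpace I →ₗ[ℝ] FieldSpace Ω a b where
  toFun w := IsTest.vec w.2
  map_add' _ _ := rfl
  map_smul' _ _ := rfl

/-- The adjoint Maxwell operator on test fields, as a linear map. -/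
def testAdjL (hΩ : IsOpen Ω) (M : Medium Ω) (I : Set ℝ) :
    testSpace I →ₗ[ℝ] FieldSpace Ω a b where
  toFun w := IsTest.adjVec hΩ M w.2
  map_add' w w' := (MemLp.toLp_congr _ ((memLp_adjOp hΩ.measurableSet M w.2).add
    (memLp_adjOp hΩ.measurableSet M w'.2)) (Eventually.of_forall fun p =>
      congrFun (adjOp_add M w.2 w'.2) p)).trans (MemLp.toLp_add _ _)
  map_smul' c w := (MemLp.toLp_congr _ ((memLp_adjOp hΩ.measurableSet M w.2).const_smul c)
    (Eventually.of_forall fun p => congrFun (adjOp_const_smul M w.2 c) p)).trans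
      (MemLp.toLp_const_smul c _)

end testSpace

/-! ### The energy estimate for the adjoint operator -/

theorem integral_fderiv_space_eq_zero {φ : ℝ × V3 → ℝ} (hφ : ContDiff ℝ ∞ φ)
    (hs : HasCompactSupport φ) (t : ℝ) (v : V3) : ∫ x, fderiv ℝ φ (t, x) (0, v) = 0 := by
  have hi : Topology.IsClosedEmbedding fun x : V3 => ((t, x) : ℝ × V3) :=
    .of_continuous_injective_isClosedMap (by fun_prop) (fun x y h => (Prod.mk.inj h).2)
      (isClosedMap_prodMk_left t)
  have hd : ∀ x, fderiv ℝ (fun x => φ (t, x)) x v = fderiv ℝ φ (t, x) (0, v) := by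
    intro x
    have h : HasFDerivAt (fun x => φ (t, x)) _ x :=
      (hφ.differentiable (by simp) (t, x)).hasFDerivAt.comp x (hasFDerivAt_prodMk_right t x)
    rw [h.fderiv]
    rfl
  have hcd : ContDiff ℝ ∞ fun x => φ (t, x) := hφ.comp (contDiff_prodMk_right t)
  have hcs : HasCompactSupport fun x => φ (t, x) := hs.comp_isClosedEmbedding hi
  have i1 : Integrable fun x => φ (t, x) := hcd.continuous.integrable_of_hasCompactSupport hcs
  have i2 : Integrable fun x => fderiv ℝ (fun x => φ (t, x)) x v :=
    ((hcd.continuous_fderiv (by simp)).clm_apply continuous_const).integrable_of_hasCompactSupport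
      (hcs.fderiv_apply ℝ v)
  -- Integration by parts against the constant `1`.
  have := integral_mul_fderiv_eq_neg_fderiv_mul_of_integrable (μ := (volume : Measure V3))
    (f := fun _ => (1 : ℝ)) (g := fun x => φ (t, x)) (v := v) (by simp) (by simpa using i2)
    (by simpa using i1) (fun x _ => differentiableAt_const _)
    (fun x _ => hcd.differentiable (by simp) x)
  simpa [hd] using this

theorem fderiv_inner_clm {F : Type*} [NormedAddCommGroup F] [InnerProductSpace ℝ F]
    {w : ℝ × V3 → F} (hw : ContDiff ℝ ∞ w) (A : F →L[ℝ] F) (hA : ∀ x y, ⟪A x, y⟫_ℝ = ⟪x, A y⟫_ℝ)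
    (p v : ℝ × V3) :
    fderiv ℝ (fun p => ⟪w p, A (w p)⟫_ℝ) p v = 2 * ⟪w p, A (fderiv ℝ w p v)⟫_ℝ := by
  have hd := (hw.differentiable (by simp) p)
  have hd2 := (contDiff_clm_comp A hw).differentiable (by simp) p
  rw [fderiv_inner_apply ℝ hd hd2, fderiv_clm_comp_apply A hw]
  have h : ⟪fderiv ℝ w p v, A (w p)⟫_ℝ = ⟪w p, A (fderiv ℝ w p v)⟫_ℝ := by
    rw [← hA, real_inner_comm]
  rw [h]
  ring

theorem contDiff_inner_clm {F : Type*} [NormedAddCommGroup F] [InnerProductSpace ℝ F]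
    {w : ℝ × V3 → F} (hw : ContDiff ℝ ∞ w) (A : F →L[ℝ] F) :
    ContDiff ℝ ∞ (fun p => ⟪w p, A (w p)⟫_ℝ) := hw.inner ℝ (contDiff_clm_comp A hw)

/-- The symbols are constant and symmetric, so each summand is half of the `i`-th derivative of `w ·
symbol i w`. Over all of `ℝ³` there is no boundary term. -/
theorem IsTest.integral_inner_spaceOp {I : Set ℝ} {w : ℝ × V3 → V6} (hw : IsTest I w) (t : ℝ) :
    ∫ x, ⟪w (t, x), spaceOp w (t, x)⟫_ℝ = 0 := by
  have hφs : ∀ i, HasCompactSupport fun p => ⟪w p, symbol i (w p)⟫_ℝ := fun i =>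
    hw.hasCompactSupport.mono fun p hp => by
      contrapose! hp
      simp only [Function.mem_support, not_not] at hp ⊢
      rw [hp, inner_zero_left]
  have hφ := fun i => contDiff_inner_clm hw.contDiff (symbol i)
  have h : ∀ i, ∫ x, 2 * ⟪w (t, x), symbol i (fderiv ℝ w (t, x)
      (0, EuclideanSpace.single i 1))⟫_ℝ = 0 := by
    intro i
    refine Eq.trans (integral_congr_ae (Eventually.of_forall fun x => ?_))
      (integral_fderiv_space_eq_zero (hφ i) (hφs i) t (EuclideanSpace.single i 1))
    exact (fderiv_inner_clm hw.contDiff (symbol i) (inner_symbol i) _ _).symm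
  simp only [spaceOp, inner_sum]
  rw [integral_finsetSum]
  · refine Finset.sum_eq_zero fun i _ => ?_
    have := h i
    rw [integral_const_mul] at this
    exact (mul_eq_zero.mp this).resolve_left two_ne_zero
  · intro i _
    have hi : Topology.IsClosedEmbedding fun x : V3 => ((t, x) : ℝ × V3) :=
      .of_continuous_injective_isClosedMap (by fun_prop) (fun x y h => (Prod.mk.inj h).2)
        (isClosedMap_prodMk_left t)
    have hc : Continuous fun p => ⟪w p, symbol i (fderiv ℝ w p
        (0, EuclideanSpace.single i 1))⟫_ℝ :=
      hw.contDiff.continuous.inner ((symbol i).continuous.comp (hw.continuous_fderiv_apply _))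
    refine (hc.comp hi.continuous).integrable_of_hasCompactSupport
      (HasCompactSupport.comp_isClosedEmbedding ?_ hi)
    refine hw.hasCompactSupport.mono fun p hp => ?_
    contrapose! hp
    simp only [Function.mem_support, not_not] at hp ⊢
    rw [hp, inner_zero_left]

/-- Multiplication by a matrix as a continuous linear map. -/
def matVecL (A : Matrix (Fin 3) (Fin 3) ℝ) : V3 →L[ℝ] V3 :=
  LinearMap.toContinuousLinearMap
    { toFun := matVec A, map_add' := matVec_add A, map_smul' := matVec_smul A }

/-- `blockVec` as a continuous linear map. -/
def blockVecL (A B : Matrix (Fin 3) (Fin 3) ℝ) : V6 →L[ℝ] V6 :=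
  (WithLp.prodContinuousLinearEquiv 2 ℝ V3 V3).symm.toContinuousLinearMap ∘L
    ((matVecL A ∘L WithLp.fstL 2 ℝ V3 V3).prod (matVecL B ∘L WithLp.sndL 2 ℝ V3 V3))

theorem blockVecL_apply (A B : Matrix (Fin 3) (Fin 3) ℝ) (v : V6) :
    blockVecL A B v = blockVec A B v := rfl

theorem cylMeasure_univ :
    cylMeasure univ a b = (volume.restrict (Icc a b)).prod (volume : Measure V3) := by
  rw [cylMeasure, Measure.volume_eq_prod, ← Measure.prod_restrict, Measure.restrict_univ]

theorem hasDerivAt_time_slice {φ : ℝ × V3 → ℝ} (hφ : ContDiff ℝ ∞ φ) (t : ℝ) (x : V3) :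
    HasDerivAt (fun t => φ (t, x)) (fderiv ℝ φ (t, x) (1, 0)) t := by
  have hp : HasDerivAt (fun t : ℝ => (t, x)) (1, 0) t :=
    (hasDerivAt_id t).prodMk (hasDerivAt_const t x)
  exact (hφ.differentiable (by simp) (t, x)).hasFDerivAt.comp_hasDerivAt t hp

/-- The integrand is the time derivative of `(t - a) w · diag(A, B) w`, which vanishes at `a` by the
weight and at `b` by the support of `w`. With `x` fixed the matrices are constant, so no regularity
of the coefficients in `x` is needed. -/
theorem IsTest.integral_time {A B : Matrix (Fin 3) (Fin 3) ℝ} (sA : A.IsSymm) (sB : B.IsSymm)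
    (hab : a ≤ b) {w : ℝ × V3 → V6} (hw : IsTest (Iio b) w) (x : V3) :
    ∫ t in Icc a b, (⟪w (t, x), blockVec A B (w (t, x))⟫_ℝ
      + 2 * ⟪(t - a) • w (t, x), blockVec A B (tDeriv w (t, x))⟫_ℝ) = 0 := by
  let φ : ℝ × V3 → ℝ := fun p => ⟪w p, blockVecL A B (w p)⟫_ℝ
  have hφ : ContDiff ℝ ∞ φ := contDiff_inner_clm hw.contDiff _
  have hφ' : ∀ p, fderiv ℝ φ p (1, 0) = 2 * ⟪w p, blockVec A B (tDeriv w p)⟫_ℝ := fun p =>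
    fderiv_inner_clm hw.contDiff (blockVecL A B) (inner_blockVec sA sB) p (1, 0)
  have hd : ∀ t, HasDerivAt (fun t => (t - a) * φ (t, x))
      (1 * φ (t, x) + (t - a) * fderiv ℝ φ (t, x) (1, 0)) t := by
    intro t
    have h1 := hasDerivAt_time_slice hφ t x
    exact ((hasDerivAt_id t).sub_const a).mul h1
  have hc : Continuous fun t => 1 * φ (t, x) + (t - a) * fderiv ℝ φ (t, x) (1, 0) := by
    have e : Continuous fun t : ℝ => (t, x) := by fun_prop
    have h2 : Continuous fun p => fderiv ℝ φ p (1, 0) :=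
      (hφ.continuous_fderiv (by simp)).clm_apply continuous_const
    exact (continuous_const.mul (hφ.continuous.comp e)).add
      ((continuous_id.sub continuous_const).mul (h2.comp e))
  have hb : φ (b, x) = 0 := by
    have : w (b, x) = 0 := by
      by_contra h
      exact lt_irrefl b (hw.mem (b, x) (subset_tsupport _ h))
    simp only [φ, this, inner_zero_left]
  have key := intervalIntegral.integral_eq_sub_of_hasDerivAt (fun t _ => hd t)
    (hc.intervalIntegrable a b)
  rw [hb, intervalIntegral.integral_of_le hab, ← integral_Icc_eq_integral_Ioc] at key
  simp only [sub_self, zero_mul, mul_zero] at key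
  rw [← key]
  refine integral_congr_ae (Eventually.of_forall fun t => ?_)
  simp only [hφ', one_mul, inner_smul_left]
  simp only [conj_trivial, φ, blockVecL_apply]
  ring

/-- The multiplier `2 (t - a) w` is used because test fields vanish near `b` but not at `a`. The
spatial term integrates to zero, the time term produces `∫ w · Γw`, and the conductivity term is
nonnegative for `t ≥ a`. -/
theorem IsTest.energy_estimate (M : Medium univ) (hab : a ≤ b) {w : ℝ × V3 → V6}
    (hw : IsTest (Iio b) w) {c : ℝ}
    (hc : ∀ x ∈ (univ : Set V3), ∀ v : V6, c * ‖v‖ ^ 2 ≤ ⟪blockVec (M.ε x) (M.μ x) v, v⟫_ℝ) :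
    ∫ p, c * ‖w p‖ ^ 2 ∂(cylMeasure univ a b)
      ≤ 2 * ∫ p, ⟪(p.1 - a) • w p, adjOp M w p⟫_ℝ ∂(cylMeasure univ a b) := by
  set m := cylMeasure univ a b with hm
  have mw : MemLp w 2 m := hw.memLp.restrict _
  have my : MemLp (fun p => (p.1 - a) • w p) 2 m :=
    (memLp_of_hasCompactSupport ((continuous_fst.sub continuous_const).smul
      hw.contDiff.continuous) (hasCompactSupport_smul_field hw.hasCompactSupport)).restrict _
  have ms : MemLp (spaceOp w) 2 m := hw.memLp_spaceOp.restrict _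
  have mg : MemLp (blockFun M.ε M.μ w) 2 m :=
    memLp_blockFun_of_memLp MeasurableSet.univ M.ε_bdd M.μ_bdd mw
  have mgt : MemLp (blockFun M.ε M.μ (tDeriv w)) 2 m :=
    memLp_blockFun_of_memLp MeasurableSet.univ M.ε_bdd M.μ_bdd (hw.memLp_tDeriv.restrict _)
  have iS : Integrable (fun p => ⟪(p.1 - a) • w p, spaceOp w p⟫_ℝ) m :=
    my.integrable_inner_two ms
  have iH : Integrable (fun p => ⟪w p, blockFun M.ε M.μ w p⟫_ℝ
      + 2 * ⟪(p.1 - a) • w p, blockFun M.ε M.μ (tDeriv w) p⟫_ℝ) m :=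
    (mw.integrable_inner_two mg).add ((my.integrable_inner_two mgt).const_mul 2)
  have iA : Integrable (fun p => ⟪(p.1 - a) • w p, adjOp M w p⟫_ℝ) m :=
    my.integrable_inner_two (memLp_adjOp MeasurableSet.univ M hw)
  have hS : ∫ p, ⟪(p.1 - a) • w p, spaceOp w p⟫_ℝ ∂m = 0 := by
    rw [hm, cylMeasure_univ] at iS ⊢
    rw [integral_prod _ iS]
    refine (integral_congr_ae (Eventually.of_forall fun t => ?_)).trans (integral_zero _ _)
    have := hw.integral_inner_spaceOp t
    simp only [inner_smul_left, integral_const_mul, this, mul_zero]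
  have hH : ∫ p, (⟪w p, blockFun M.ε M.μ w p⟫_ℝ
      + 2 * ⟪(p.1 - a) • w p, blockFun M.ε M.μ (tDeriv w) p⟫_ℝ) ∂m = 0 := by
    rw [hm, cylMeasure_univ] at iH ⊢
    rw [integral_prod_symm _ iH]
    refine (integral_congr_ae (Eventually.of_forall fun x => ?_)).trans (integral_zero _ _)
    exact hw.integral_time (M.ε_pos.1 x trivial) (M.μ_pos.1 x trivial) hab x
  -- Adding the two vanishing integrals leaves the integrand `w · Γw + 2 (t - a) σw · w`, which
  -- dominates `c ‖w‖²` pointwise.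
  have hsum : ∫ p, (2 * ⟪(p.1 - a) • w p, adjOp M w p⟫_ℝ
      - 2 * ⟪(p.1 - a) • w p, spaceOp w p⟫_ℝ
      + (⟪w p, blockFun M.ε M.μ w p⟫_ℝ
      + 2 * ⟪(p.1 - a) • w p, blockFun M.ε M.μ (tDeriv w) p⟫_ℝ)) ∂m
      = 2 * ∫ p, ⟪(p.1 - a) • w p, adjOp M w p⟫_ℝ ∂m := by
    have iAS : Integrable (fun p => 2 * ⟪(p.1 - a) • w p, adjOp M w p⟫_ℝ
        - 2 * ⟪(p.1 - a) • w p, spaceOp w p⟫_ℝ) m := (iA.const_mul 2).sub (iS.const_mul 2)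
    rw [integral_add iAS iH,
      integral_sub (iA.const_mul 2) (iS.const_mul 2), hH, integral_const_mul, integral_const_mul,
      hS]
    ring
  rw [← hsum]
  refine integral_mono_ae ((mw.integrable_norm_pow (by norm_num)).const_mul c)
    (((iA.const_mul 2).sub (iS.const_mul 2)).add iH) ?_
  filter_upwards [ae_mem_cyl (a := a) (b := b) MeasurableSet.univ] with p hp
  have h1 := hc p.2 trivial (w p)
  have h2 : 0 ≤ (p.1 - a) * ⟪blockVec (M.σ p.2) 0 (w p), w p⟫_ℝ :=
    mul_nonneg (sub_nonneg.mpr hp.1.1) (M.inner_σ_nonneg hp.2 _)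
  have h3 := inner_adjOp M w hp.2 ((p.1 - a) • w p)
  rw [blockVec_smul (M.σ p.2), inner_smul_left (blockVec _ _ _)] at h3
  rw [inner_blockVec (M.ε_pos.1 _ hp.2) (M.μ_pos.1 _ hp.2)] at h1 h3
  simp only [conj_trivial] at h3
  simp only [blockFun_apply, h3]
  linarith

theorem norm_sq_eq_integral (u : FieldSpace Ω a b) :
    ‖u‖ ^ 2 = ∫ p, ‖u p‖ ^ 2 ∂(cylMeasure Ω a b) := by
  rw [← real_inner_self_eq_norm_sq, inner_eq_integral]
  simp only [real_inner_self_eq_norm_sq]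

/-- On the cylinder `0 ≤ t - a ≤ b - a`. Cauchy–Schwarz in the energy estimate and division by `‖w‖`
give the constant. -/
theorem IsTest.norm_vec_le (M : Medium univ) (hab : a ≤ b) {w : ℝ × V3 → V6}
    (hw : IsTest (Iio b) w) {c : ℝ} (hc0 : 0 < c)
    (hc : ∀ x ∈ (univ : Set V3), ∀ v : V6, c * ‖v‖ ^ 2 ≤ ⟪blockVec (M.ε x) (M.μ x) v, v⟫_ℝ) :
    ‖(hw.vec : FieldSpace univ a b)‖
      ≤ 2 * (b - a) / c * ‖(hw.adjVec isOpen_univ M : FieldSpace univ a b)‖ := by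
  set W : FieldSpace univ a b := hw.vec
  set L : FieldSpace univ a b := hw.adjVec isOpen_univ M
  have my : MemLp (fun p => (p.1 - a) • w p) 2 (cylMeasure univ a b) :=
    (memLp_of_hasCompactSupport ((continuous_fst.sub continuous_const).smul
      hw.contDiff.continuous) (hasCompactSupport_smul_field hw.hasCompactSupport)).restrict _
  set Y : FieldSpace univ a b := my.toLp _
  have eW : W =ᵐ[cylMeasure univ a b] w := MemLp.coeFn_toLp _
  have eL : L =ᵐ[cylMeasure univ a b] adjOp M w := MemLp.coeFn_toLp _
  have eY : Y =ᵐ[cylMeasure univ a b] fun p => (p.1 - a) • w p := MemLp.coeFn_toLp _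
  have hY : ‖Y‖ ≤ (b - a) * ‖W‖ := by
    refine Lp.norm_le_mul_norm_of_ae_le_mul ?_
    filter_upwards [eW, eY, ae_mem_cyl (a := a) (b := b) MeasurableSet.univ] with p h1 h2 h3
    rw [h1, h2, norm_smul, Real.norm_of_nonneg (sub_nonneg.mpr h3.1.1)]
    exact mul_le_mul_of_nonneg_right (sub_le_sub_right h3.1.2 a) (norm_nonneg _)
  have h1 : c * ‖W‖ ^ 2 ≤ 2 * ⟪Y, L⟫_ℝ := by
    have e1 : c * ‖W‖ ^ 2 = ∫ p, c * ‖w p‖ ^ 2 ∂(cylMeasure univ a b) := by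
      rw [norm_sq_eq_integral, integral_const_mul]
      congr 1
      refine integral_congr_ae ?_
      filter_upwards [eW] with p hp
      rw [hp]
    have e2 : ⟪Y, L⟫_ℝ = ∫ p, ⟪(p.1 - a) • w p, adjOp M w p⟫_ℝ ∂(cylMeasure univ a b) := by
      rw [inner_eq_integral]
      refine integral_congr_ae ?_
      filter_upwards [eY, eL] with p hp hp'
      rw [hp, hp']
    rw [e1, e2]
    exact hw.energy_estimate M hab hc
  have h2 : c * ‖W‖ ^ 2 ≤ 2 * (b - a) * ‖L‖ * ‖W‖ := by
    refine h1.trans ?_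
    have := (real_inner_le_norm Y L).trans (mul_le_mul_of_nonneg_right hY (norm_nonneg L))
    linarith
  rcases (norm_nonneg W).eq_or_lt with h0 | h0
  · rw [← h0]
    have := sub_nonneg.mpr hab
    positivity
  · rw [div_mul_eq_mul_div, le_div_iff₀ hc0]
    refine le_of_mul_le_mul_right ?_ h0
    linarith

/-- By the a priori bound, `adjOp M w ↦ ⟨q, w⟩` is a well-defined bounded functional on the range of
the adjoint operator. A vector that represents it is a weak solution. -/
theorem mem_sourceDomain_univ (M : Medium univ) (hab : a ≤ b) (q : FieldSpace univ a b) :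
    q ∈ sourceDomain M a b := by
  obtain ⟨c, hc0, hc⟩ := M.exists_coercive
  obtain ⟨u, hu⟩ := exists_inner_eq_of_le (testAdjL (a := a) (b := b) isOpen_univ M (Iio b))
    ((innerSL ℝ q).toLinearMap ∘ₗ testVecL (Iio b)) (‖q‖ * (2 * (b - a) / c)) fun w => by
      refine (abs_real_inner_le_norm q _).trans ?_
      rw [mul_assoc]
      exact mul_le_mul_of_nonneg_left (IsTest.norm_vec_le M hab w.2 hc0 hc) (norm_nonneg q)
  exact ⟨u, (isMaxwellSolution_iff_inner isOpen_univ M q u).mpr fun w hw => hu ⟨w, hw⟩⟩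

/-! ### The adjoint of the source-to-field operator -/

theorem sourceToField_eq (hΩ : IsOpen Ω) {M : Medium Ω} {q u : FieldSpace Ω a b}
    (h : IsMaxwellSolution M q u) : sourceToField M q = u :=
  (isMaxwellSolution_sourceToField ⟨u, h⟩).unique hΩ h

/-- The source-to-field operator as a continuous linear map, if it is defined everywhere. -/
def sourceToFieldL (hΩ : IsOpen Ω) (M : Medium Ω)
    (h : ∀ q : FieldSpace Ω a b, q ∈ sourceDomain M a b) :
    FieldSpace Ω a b →L[ℝ] FieldSpace Ω a b :=
  ContinuousLinearMap.ofIsClosedGraph (g :=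
    { toFun := sourceToField M
      map_add' := fun q q' => sourceToField_eq hΩ
        ((isMaxwellSolution_sourceToField (h q)).add hΩ (isMaxwellSolution_sourceToField (h q')))
      map_smul' := fun c q => sourceToField_eq hΩ
        ((isMaxwellSolution_sourceToField (h q)).smul hΩ c) }) <| by
    -- Existence and uniqueness identify the graph with the set of pairs that satisfy the weak
    -- equations, which is closed.
    convert! isClosed_isMaxwellSolution (a := a) (b := b) hΩ M using 1
    ext ⟨q, u⟩
    simp only [SetLike.mem_coe, LinearMap.mem_graph_iff, mem_ofPred_eq]
    constructor
    · intro hu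
      rw [hu]
      exact isMaxwellSolution_sourceToField (h q)
    · intro hu
      exact (sourceToField_eq hΩ hu).symm

/-- The adjoint of the source-to-field operator for the energy inner product. -/
def fieldAdjoint (hΩ : IsOpen Ω) (M : Medium Ω)
    (h : ∀ q : FieldSpace Ω a b, q ∈ sourceDomain M a b) :
    FieldSpace Ω a b →L[ℝ] FieldSpace Ω a b :=
  -- From `⟨F q, v⟩_U = ⟨F q, Γ v⟩ = ⟨q, F† Γ v⟩`; the factor `Γ⁻¹` turns the last product into an
  -- energy product.
  M.gammaInvL hΩ ∘L ContinuousLinearMap.adjoint (sourceToFieldL hΩ M h) ∘L M.gammaL hΩ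

theorem energyInner_fieldAdjoint (hΩ : IsOpen Ω) (M : Medium Ω)
    (h : ∀ q : FieldSpace Ω a b, q ∈ sourceDomain M a b) (q v : FieldSpace Ω a b) :
    M.energyInner (sourceToField M q) v = M.energyInner q (fieldAdjoint hΩ M h v) := by
  rw [M.energyInner_eq hΩ, M.energyInner_eq hΩ]
  change _ = ⟪q, M.gamma hΩ (M.gammaInv hΩ _)⟫_ℝ
  rw [M.gamma_gammaInv]
  exact (ContinuousLinearMap.adjoint_inner_right (sourceToFieldL hΩ M h) q (M.gamma hΩ v)).symm

end

theorem theorem11p2 (Ω : Set V3) (hΩ : IsOpen Ω) (M : Medium Ω) (T : ℝ) (hT : 0 < T) :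
    -- a source generates at most one field, so that `F` is well defined on its domain
    (∀ a b : ℝ, a < b → ∀ q u u' : FieldSpace Ω a b,
      IsMaxwellSolution M q u → IsMaxwellSolution M q u' → u = u') ∧
    -- in the whole space `F` is defined everywhere
    (Ω = univ → ∀ a b : ℝ, a < b → ∀ q : FieldSpace Ω a b, q ∈ sourceDomain M a b) ∧
    -- if no energy of the time-reversal experiment for `v` reaches the boundary, then
    -- `Γ⁻¹ 𝒮_e F 𝒮_e Γ v` is a value of `F*` at `v`, the only one if `F` is densely defined
    (∀ v : FieldSpace Ω 0 T, emReversal hΩ T (M.gamma hΩ v) ∈ sourceDomain M T (2 * T) →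
      IsAdjointValue M v (reversalExperiment hΩ M T v) ∧
      (Dense (sourceDomain M 0 T) →
        ∀ z : FieldSpace Ω 0 T, IsAdjointValue M v z → z = reversalExperiment hΩ M T v)) ∧
    -- if no energy reaches the boundary at all, so that `F` is defined everywhere, then it is a
    -- bounded linear operator with a unique adjoint `F*`, and `Γ⁻¹ 𝒮_e F 𝒮_e Γ = F*`
    ((∀ q : FieldSpace Ω 0 T, q ∈ sourceDomain M 0 T) →
      (∀ q : FieldSpace Ω T (2 * T), q ∈ sourceDomain M T (2 * T)) →
      ∃ F Fstar : FieldSpace Ω 0 T →L[ℝ] FieldSpace Ω 0 T,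
        (∀ q, F q = sourceToField M q) ∧
        (∀ G : FieldSpace Ω 0 T → FieldSpace Ω 0 T,
          (∀ q v, M.energyInner (F q) v = M.energyInner q (G v)) ↔ G = Fstar) ∧
        ∀ v, reversalExperiment hΩ M T v = Fstar v) := by
  refine ⟨fun a b _ q u u' h h' => h.unique hΩ h', ?_, fun v hv => ?_, fun h h' => ?_⟩
  · rintro rfl a b hab q
    exact mem_sourceDomain_univ M hab.le q
  · have hz := isAdjointValue_reversalExperiment hΩ M T v hv
    exact ⟨hz, fun hd z hz' => eq_of_isAdjointValue hΩ hd hz' hz⟩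
  · have hd : Dense (sourceDomain M 0 T) := by
      rw [show sourceDomain M 0 T = univ from eq_univ_of_forall h]
      exact dense_univ
    have hadj : ∀ v, IsAdjointValue M v (fieldAdjoint hΩ M h v) := fun v q _ =>
      energyInner_fieldAdjoint hΩ M h q v
    refine ⟨sourceToFieldL hΩ M h, fieldAdjoint hΩ M h, fun q => rfl, fun G => ⟨fun hG => ?_, ?_⟩,
      fun v => ?_⟩
    -- `G` is an arbitrary map: each single value `G v` is already fixed by the adjoint identity, so
    -- linearity and continuity come for free.
    · funext v
      exact eq_of_isAdjointValue hΩ hd (fun q _ => hG q v) (hadj v)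
    · rintro rfl q v
      exact energyInner_fieldAdjoint hΩ M h q v
    · exact eq_of_isAdjointValue hΩ hd (isAdjointValue_reversalExperiment hΩ M T v (h' _)) (hadj v)
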